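/- Let $D_0$ be the graph with two vertices joined by one edge and let $D_{m+1}$ be obtained from $D_m$ by replacing every edge $\{x,y\}$ by a diamond, i.e. by two new vertices $w,w'$ and the four edges $xw, wy, xw', w'y$. Let $$Z(D_m,q,v)=\sum_{A\subseteq E(D_m)}q^{k(A)}v^{|A|}$$ be the Potts partition function, where $k(A)$ is the number of connected components of the spanning subgraph with edge set $A$. For $v_0\in\mathbb C$ let $L_q(v_0)\subset\mathbb C$ be the set of all points $q$ such that every neighbourhood of $q$ contains a zero of $Z(D_m,\cdot,v_0)$ for infinitely many $m$, and let the continuous accumulation locus $\mathcal B_q(v_0)$ be the set $L_q(v_0)$ without its isolated points. Let $F_q$ be the map $$F_q(v)=\frac{v^2(2q+4v+v^2)}{(q+2v)^2}$$ of the Riemann sphere, with $F_q(\infty)=\infty$ (for $q=0$ the common factor is cancelled, so $F_0(v)=v+v^2/4$). **Theorem.** Let $v_0>0$ be real and $q_\pm=q_\pm(v_0)=\left(-1\pm\sqrt{1+v_0}\right)v_0$. Then $q_-<q_+$, and: 1. The locus $\mathcal B_q(v_0)$ meets the real $q$-axis exactly in the two points $q_-$ and $q_+$. 2. Every real $q\ne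 q_\pm$ has a neighbourhood in $\mathbb C$ in which, for all sufficiently large $m$, $Z(D_m,\cdot,v_0)$ has no zero except possibly the trivial zero $q=0$. 3. If $q$ is real and $q<q_-$ or $q>q_+$, then $v_0$ lies in the basin of the fixed point $0$ of $F_q$, i.e. $F_q^m(v_0)\to 0$ as $m\to\infty$. 4. If $q$ is real and $q_-<q<q_+$, then $v_0$ lies in the basin of the fixed point $\infty$ of $F_q$, i.e. $F_q^m(v_0)\to\infty$ on the Riemann sphere as $m\to\infty$. -/

import Mathlib

open Filter Topology

/-- The graph obtained from `G` by replacing each edge `e = {x, y}` with a diamond: two new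
vertices `(e, false)`, `(e, true)` are added, each of them is joined to both ends of `e`, and `e`
itself is removed. -/
def diamondSubst {V : Type} (G : SimpleGraph V) : SimpleGraph (V ⊕ G.edgeSet × Bool) where
  Adj
    | Sum.inl x, Sum.inr p => x ∈ p.1.1
    | Sum.inr p, Sum.inl x => x ∈ p.1.1
    | _, _ => False
  symm := ⟨by rintro (x | p) (y | r) h <;> exact h⟩
  loopless := ⟨by rintro (x | p) h <;> exact h⟩

/-- The diamond hierarchical graph with its vertex type: at stage `0` a single edge joining two
vertices, at stage `m + 1` the stage `m` graph with every edge replaced by a diamond. -/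
def diamondStage : ℕ → Σ V : Type, SimpleGraph V
  | 0 => ⟨Bool, ⊤⟩
  | m + 1 => ⟨_, diamondSubst (diamondStage m).2⟩

/-- The vertex set of the diamond hierarchical graph `D_m`. -/
abbrev DiamondVertex (m : ℕ) : Type := (diamondStage m).1

/-- The diamond hierarchical graph `D_m`. -/
abbrev diamondGraph (m : ℕ) : SimpleGraph (DiamondVertex m) := (diamondStage m).2

instance diamondVertexFinite (m : ℕ) : Finite (DiamondVertex m) := by
  induction m with
  | zero => exact inferInstanceAs (Finite Bool)
  | succ m ih =>
    have : Finite (diamondStage m).1 := ih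
    exact inferInstanceAs
      (Finite ((diamondStage m).1 ⊕ (diamondStage m).2.edgeSet × Bool))

/-- The Potts partition function `Z(G, q, v) = ∑ q ^ k(G') * v ^ e(G')`, the sum being over all
spanning subgraphs `G' = (V, A)` of `G` (that is, over all subsets `A` of the edge set), where
`k(G')` is the number of connected components and `e(G')` the number of edges of `G'`. -/
noncomputable def pottsZ {V : Type} [Finite V] (G : SimpleGraph V) (q v : ℂ) : ℂ :=
  ∑ A ∈ G.edgeSet.toFinite.toFinset.powerset,
    q ^ Nat.card (SimpleGraph.fromEdgeSet (A : Set (Sym2 V))).ConnectedComponent * v ^ A.card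

/-- The limit set of the zeros of `Z(D_m, ·, v₀)` as `m → ∞`: the points of the `q`-plane every
neighbourhood of which contains a zero of `Z(D_m, ·, v₀)` for infinitely many `m`. -/
def zeroLimitSet (v₀ : ℂ) : Set ℂ :=
  {q | ∀ U ∈ 𝓝 q, ∃ᶠ m in atTop, ∃ z ∈ U, pottsZ (diamondGraph m) z v₀ = 0}

/-- The continuous accumulation locus `𝓑_q(v₀)` of the zeros of `Z(D_m, ·, v₀)`: the limit set of
the zeros without its isolated points. (The limit set is closed, so its derived set is a subset.) -/
def continuousLocus (v₀ : ℂ) : Set ℂ := derivedSet (zeroLimitSet v₀)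

/-- The renormalization map `F_q(v) = v² (2q + 4v + v²) / (q + 2v)²` as a self-map of the Riemann
sphere. At `v = -q/2 ≠ 0` it has a pole. For `q = 0` it is `v ↦ v + v² / 4`; the value at `v = 0`
is then `0 / 0 = 0`, as it should be. -/
noncomputable def renormMap (q : ℂ) : OnePoint ℂ → OnePoint ℂ
  | OnePoint.infty => OnePoint.infty
  | OnePoint.some v =>
    open Classical in
    if v ≠ 0 ∧ q + 2 * v = 0 then OnePoint.infty
    else ((v ^ 2 * (2 * q + 4 * v + v ^ 2) / (q + 2 * v) ^ 2 : ℂ) : OnePoint ℂ)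

/-- The parameters `q` for which `v₀` lies in the basin of the point `p` of the Riemann sphere:
`F_q^m(v₀) → p` as `m → ∞`. -/
def basinLocus (p : OnePoint ℂ) (v₀ : ℂ) : Set ℂ :=
  {q | Tendsto (fun m : ℕ => (renormMap q)^[m] (v₀ : OnePoint ℂ)) atTop (𝓝 p)}

/-- `q_-(v₀) = (-1 - √(1 + v₀)) v₀`. -/
noncomputable def qMinus (v₀ : ℝ) : ℝ := (-1 - Real.sqrt (1 + v₀)) * v₀

/-- `q_+(v₀) = (-1 + √(1 + v₀)) v₀`. -/
noncomputable def qPlus (v₀ : ℝ) : ℝ := (-1 + Real.sqrt (1 + v₀)) * v₀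

/-!
# Zeros of the Potts partition function on the diamond hierarchical lattice

**Renormalization.** For `q = n` a natural number, `Z(G, n, v)` is a sum over colourings of the
vertices with `n` colours of a product of edge weights (`spinSum_one`). Summing out the two new
vertices of each diamond replaces the edge weight by its image under the renormalization map
(`spinSum_diamondSubst`). In homogeneous coordinates `v = N / D` the map is a polynomial map
`potStep q` of pairs, both sides are polynomials in `q`, and so
`Z(D_m, q, v) = q (q D_m + N_m)` for all complex `q`, where `(N_m, D_m)` is the orbit of `(v, 1)`
(`pottsZ_diamondGraph`).

**Real parameters.** For real `q`, `F_q(x) - x = x f(x) / (q + 2x)²` with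
`f(x) = x³ - 2qx - q²`, and `f(v₀) = -(q - q₋)(q - q₊)`. Hence `v₀` is a fixed point exactly at
`q = q₋` and `q = q₊`; the sign of `f` makes the real orbit of `v₀` converge to `0` outside
`[q₋, q₊]` and to `∞` inside. Both points are superattracting (`∞` for all `q`, and `0` for
`q ≠ 0`), and neighbourhoods of them are trapping uniformly in `q` near a given value
(`potStep_trap_zero`, `potStep_trap_infty`). A trapped orbit does not meet `-q`, which gives the
zero-free neighbourhoods (`eventuallyZeroFree_of_ne`), and hence that no real `q ≠ q₋, q₊` belongs
to the locus.

**The critical parameters.** It remains to see that `q₋` and `q₊` are accumulation points of the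
limit set of the zeros. Write `v₀ = σ² - 1` and `q₀ = (σ - 1)²(σ + 1)`; then `q₀ = q₊` for
`σ = √(1 + v₀)` and `q₀ = q₋` for `σ = -√(1 + v₀)`. Here `v₀` is a repelling fixed point of
`F_{q₀}`, and there is an explicit inverse branch `G` of `F` with `G q₀ v₀ = v₀` which maps the
slit plane `ℂ \ (-∞, 0]` into itself (`InverseBranch`). By the Schwarz lemma all orbits of
`G q₀` in the slit plane converge to `v₀` (`InverseBranch.tendsto_iterate`).

The parameter is uniformized by `q = sin² t (2 + sin t)`, for which `sin t (2 + sin t)` is the fixed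
point that continues `v₀`. Suppose that at a parameter `t₁` some iterate of `v₀` lands on this fixed
point, and let `a` be a holomorphic function near `t₁` whose value lies in the disc where `G`
contracts. The backward orbit `Gⁿ a` tends uniformly to the fixed point, so Hurwitz' theorem gives,
for all large `n`, parameters near `t₁` at which the orbit of `v₀` passes through `a`
(`InverseBranch.eventually_exists_param`). This is used twice.

* At `t₀`, the parameter of `q₀`, with `a` obtained from a nonreal second preimage of the fixed
  point (`exists_homoclinic`): there are `t₁` arbitrarily near `t₀` with `q(t₁) ≠ q₀` at which an
  iterate of `v₀` lands on the fixed point.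
* At each such `t₁`, with `a` obtained from a backward orbit of `-q`: the zeros of `Z(D_m, ·, v₀)`
  accumulate at `q(t₁)`.

If `q₀ ≠ 1`, a nonreal preimage of `-q₀` serves for the second step (`exists_target_of_ne_one`). If
`q₀ = 1`, which happens when `v₀` is the golden ratio, `-q₀ = -1` is an exceptional point of
`F_{q₀}`: it is its own only preimage. For `q(t₁) ≠ 1` near `1`, however, the point `-q(t₁)` does
have a backward orbit that leaves a neighbourhood of `-1` of fixed size through the upper half-plane
(`exists_target_near_one`).
-/

/-! ### The partition function as an orbit of the renormalization map -/

/-- The renormalization map `F_q` in homogeneous coordinates: it sends `v = N / D` to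
`N' / D'` for `(N', D') = potStep q (N, D)`. The pair `(0, 0)` is allowed. -/
noncomputable def potStep (q : ℂ) (x : ℂ × ℂ) : ℂ × ℂ :=
  (x.1 ^ 2 * (2 * q * x.2 ^ 2 + 4 * x.1 * x.2 + x.1 ^ 2), (x.2 * (q * x.2 + 2 * x.1)) ^ 2)

open Classical in
/-- The spin form of the Potts model with `n` colours. The pair `x = (N, D)` gives an edge the
weight `D + N` if its ends have the same colour and `D` otherwise, so `(v, 1)` is the usual
weight. -/
noncomputable def spinSum {V : Type} [Finite V] (G : SimpleGraph V) (n : ℕ) (x : ℂ × ℂ) : ℂ :=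
  ∑ᶠ s : V → Fin n, ∏ e ∈ G.edgeSet.toFinite.toFinset,
    (x.2 + if (Sym2.map s e).IsDiag then x.1 else 0)

/-- Colourings that are constant along the edges in `A` are functions on the set of components. -/
lemma card_colorings_constOn {V : Type} [Finite V] (n : ℕ) (A : Set (Sym2 V)) :
    Nat.card {s : V → Fin n // ∀ e ∈ A, (Sym2.map s e).IsDiag} =
      n ^ Nat.card (SimpleGraph.fromEdgeSet A).ConnectedComponent := by
  classical
  have key : ∀ s : V → Fin n, (∀ e ∈ A, (Sym2.map s e).IsDiag) → ∀ x y,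
      (SimpleGraph.fromEdgeSet A).Reachable x y → s x = s y := by
    rintro s hs x y ⟨p⟩
    induction p with
    | nil => rfl
    | cons h p ih =>
      refine Eq.trans ?_ ih
      simpa using hs _ ((SimpleGraph.fromEdgeSet_adj _).1 h).1
  let E : {s : V → Fin n // ∀ e ∈ A, (Sym2.map s e).IsDiag} ≃
      ((SimpleGraph.fromEdgeSet A).ConnectedComponent → Fin n) :=
    { toFun := fun s => Quot.lift s.1 (fun x y h => key s.1 s.2 x y h)
      invFun := fun f => ⟨fun x => f (SimpleGraph.connectedComponentMk _ x), by
        intro e he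
        induction e with
        | h x y =>
          simp only [Sym2.map_mk, Sym2.mk_isDiag_iff]
          by_cases hxy : x = y
          · simp [hxy]
          · congr 1
            exact SimpleGraph.ConnectedComponent.sound
              (SimpleGraph.Adj.reachable ((SimpleGraph.fromEdgeSet_adj _).2 ⟨he, hxy⟩))⟩
      left_inv := fun s => rfl
      right_inv := fun f => by
        funext c
        induction c using SimpleGraph.ConnectedComponent.ind
        rfl }
  rw [Nat.card_congr E, Nat.card_fun]
  simp

/-- The Fortuin–Kasteleyn expansion. -/
lemma spinSum_one {V : Type} [Finite V] (G : SimpleGraph V) (n : ℕ) (v : ℂ) :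
    spinSum G n (v, 1) = pottsZ G n v := by
  classical
  let := Fintype.ofFinite V
  simp only [spinSum, pottsZ, finsum_eq_sum_of_fintype]
  simp_rw [add_comm (1 : ℂ), Finset.prod_add_one]
  rw [Finset.sum_comm]
  refine Finset.sum_congr rfl fun A _ => ?_
  have : ∀ s : V → Fin n, (∏ e ∈ A, if (Sym2.map s e).IsDiag then v else 0) =
      if ∀ e ∈ A, (Sym2.map s e).IsDiag then v ^ A.card else 0 := by
    intro s
    split_ifs with h
    · rw [Finset.prod_congr rfl (fun e he => if_pos (h e he))]
      simp
    · push Not at h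
      obtain ⟨e, he, h⟩ := h
      exact Finset.prod_eq_zero he (if_neg h)
  rw [Finset.sum_congr rfl (fun s _ => this s), ← Finset.sum_filter, Finset.sum_const, nsmul_eq_mul]
  congr 1
  have := card_colorings_constOn n (A : Set (Sym2 V))
  rw [Nat.card_eq_fintype_card, Fintype.card_subtype] at this
  rw [← Nat.cast_pow, ← this]
  simp

/-- The edges of `diamondSubst G` correspond to pairs of a new vertex and an end of the old edge it
subdivides. -/
noncomputable def diamondEdgeEquiv {V : Type} (G : SimpleGraph V) :
    (Σ p : G.edgeSet × Bool, {x : V // x ∈ p.1.1}) ≃ (diamondSubst G).edgeSet :=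
  Equiv.ofBijective
    (fun t => ⟨s(Sum.inl t.2.1, Sum.inr t.1), t.2.2⟩) (by
      constructor
      · rintro ⟨p, x, hx⟩ ⟨p', x', hx'⟩ h
        have h' := congrArg Subtype.val h
        simp only [Sym2.eq_iff, Sum.inl.injEq, Sum.inr.injEq, reduceCtorEq, and_self,
          or_false] at h'
        obtain ⟨rfl, rfl⟩ := h'
        rfl
      · rintro ⟨e, he⟩
        induction e with
        | h a b =>
          rcases a with a | a <;> rcases b with b | b
          · exact he.elim
          · exact ⟨⟨b, a, he⟩, rfl⟩
          · exact ⟨⟨a, b, he⟩, Subtype.ext (Sym2.eq_swap)⟩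
          · exact he.elim)

lemma prod_mem_sym2 {V : Type} [Fintype V] [DecidableEq V] (e : Sym2 V) [Fintype {x // x ∈ e}]
    (f : V → ℂ) (x y : V) (hxy : x ≠ y) (he : e = s(x, y)) :
    ∏ z : {x // x ∈ e}, f z.1 = f x * f y := by
  subst he
  rw [← Finset.prod_pair hxy]
  symm
  refine Finset.prod_subtype _ (fun z => by simp) _

lemma sum_spin_pair (n : ℕ) (N D : ℂ) (a b : Fin n) :
    ∑ t : Fin n, (D + if a = t then N else 0) * (D + if b = t then N else 0) =
      n * D ^ 2 + 2 * N * D + if a = b then N ^ 2 else 0 := by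
  have : ∀ t : Fin n, (D + if a = t then N else 0) * (D + if b = t then N else 0) =
      D ^ 2 + (if a = t then N * D else 0) + (if b = t then N * D else 0) +
        (if b = t then (if a = b then N ^ 2 else 0) else 0) := by
    intro t
    by_cases h1 : a = t <;> by_cases h2 : b = t <;> simp [h1, h2] <;> try ring
  simp_rw [this, Finset.sum_add_distrib]
  simp
  ring

/-- Summing over the colours of the new vertices renormalizes the edge weight. -/
lemma spinSum_diamondSubst {V : Type} [Finite V] (G : SimpleGraph V)
    [Finite (V ⊕ G.edgeSet × Bool)] (n : ℕ) (x : ℂ × ℂ) :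
    spinSum (diamondSubst G) n x = spinSum G n (potStep n x) := by
  classical
  let := Fintype.ofFinite V
  simp only [spinSum, finsum_eq_sum_of_fintype]
  rw [← (Equiv.sumArrowEquivProdArrow V (G.edgeSet × Bool) (Fin n)).symm.sum_comp]
  rw [Fintype.sum_prod_type]
  refine Finset.sum_congr rfl fun s _ => ?_
  have h1 : ∀ t : G.edgeSet × Bool → Fin n,
      ∏ e ∈ (diamondSubst G).edgeSet.toFinite.toFinset,
        (x.2 + if (Sym2.map ((Equiv.sumArrowEquivProdArrow V (G.edgeSet × Bool)
          (Fin n)).symm (s, t)) e).IsDiag then x.1 else 0) =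
      ∏ p : G.edgeSet × Bool, ∏ z : {z : V // z ∈ p.1.1},
        (x.2 + if s z.1 = t p then x.1 else 0) := by
    intro t
    rw [← Fintype.prod_sigma']
    rw [Finset.prod_subtype (p := fun e => e ∈ (diamondSubst G).edgeSet) _ (fun e => by simp)]
    rw [← Equiv.prod_comp (diamondEdgeEquiv G)]
    exact Finset.prod_congr rfl fun u _ => congrArg (x.2 + ·) (if_congr Iff.rfl rfl rfl)
  rw [Finset.sum_congr rfl (fun t _ => h1 t)]
  rw [← Fintype.piFinset_univ, ← Finset.prod_univ_sum (fun _ => Finset.univ)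
    (fun (p : G.edgeSet × Bool) (j : Fin n) => ∏ z : {z : V // z ∈ p.1.1},
        (x.2 + if s z.1 = j then x.1 else 0)), Fintype.prod_prod_type]
  rw [Finset.prod_subtype (p := fun e => e ∈ G.edgeSet) _ (fun e => by simp)]
  refine Finset.prod_congr rfl fun e _ => ?_
  obtain ⟨e, he⟩ := e
  induction e with
  | h a b =>
    have hab : a ≠ b := by
      rintro rfl
      exact G.loopless.irrefl _ he
    have h2 : ∀ j : Fin n, ∏ z : {z : V // z ∈ s(a, b)}, (x.2 + if s z.1 = j then x.1 else 0) =
        (x.2 + if s a = j then x.1 else 0) * (x.2 + if s b = j then x.1 else 0) := fun j =>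
      prod_mem_sym2 s(a, b) (fun z => x.2 + if s z = j then x.1 else 0) a b hab rfl
    simp only [h2, sum_spin_pair]
    simp only [potStep, Finset.prod_const, Finset.card_univ, Fintype.card_bool, Sym2.map_mk,
      Sym2.mk_isDiag_iff]
    split_ifs <;> ring

lemma spinSum_diamondGraph (n m : ℕ) (x : ℂ × ℂ) :
    spinSum (diamondGraph m) n x =
      n * (n * ((potStep n)^[m] x).2 + ((potStep n)^[m] x).1) := by
  induction m generalizing x with
  | zero =>
    classical
    change spinSum (⊤ : SimpleGraph Bool) n x = _
    simp only [spinSum, finsum_eq_sum_of_fintype]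
    have hE : ((⊤ : SimpleGraph Bool).edgeSet.toFinite.toFinset) = {s(false, true)} := by
      ext e
      induction e with
      | h a b => cases a <;> cases b <;> simp
    rw [hE]
    simp only [Finset.prod_singleton, Sym2.map_mk, Sym2.mk_isDiag_iff,
      Function.iterate_zero, id]
    refine (Fintype.sum_equiv (Equiv.boolArrowEquivProd (Fin n)) _
      (fun p => x.2 + if p.1 = p.2 then x.1 else 0)
      (fun s => by simp [Equiv.boolArrowEquivProd]; congr)).trans ?_
    rw [Fintype.sum_prod_type]
    simp [Finset.sum_add_distrib]
    ring
  | succ m ih =>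
    rw [Function.iterate_succ_apply, ← ih]
    exact spinSum_diamondSubst _ n x

lemma exists_polynomial_iterate_potStep (v : ℂ) (m : ℕ) : ∃ P Q : Polynomial ℂ, ∀ q,
    (potStep q)^[m] (v, 1) = (P.eval q, Q.eval q) := by
  induction m with
  | zero => exact ⟨Polynomial.C v, 1, fun q => by simp⟩
  | succ m ih =>
    obtain ⟨P, Q, h⟩ := ih
    refine ⟨P ^ 2 * (2 * Polynomial.X * Q ^ 2 + 4 * P * Q + P ^ 2),
      (Q * (Polynomial.X * Q + 2 * P)) ^ 2, fun q => ?_⟩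
    rw [Function.iterate_succ_apply', h]
    simp [potStep]

/-- Both sides are polynomials in `q`, so it suffices to compare them at the natural numbers, where
the spin form is available. -/
theorem pottsZ_diamondGraph (m : ℕ) (q v : ℂ) :
    pottsZ (diamondGraph m) q v =
      q * (q * ((potStep q)^[m] (v, 1)).2 + ((potStep q)^[m] (v, 1)).1) := by
  obtain ⟨P, Q, h⟩ := exists_polynomial_iterate_potStep v m
  let Z : Polynomial ℂ := ∑ A ∈ (diamondGraph m).edgeSet.toFinite.toFinset.powerset,
    Polynomial.X ^ Nat.card (SimpleGraph.fromEdgeSet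
      (A : Set (Sym2 (DiamondVertex m)))).ConnectedComponent * Polynomial.C (v ^ A.card)
  have hZ : ∀ q, pottsZ (diamondGraph m) q v = Z.eval q := fun q => by
    simp [Z, pottsZ, Polynomial.eval_finsetSum]
  have hpoly : Z = Polynomial.X * (Polynomial.X * Q + P) := by
    refine Polynomial.eq_of_infinite_eval_eq _ _ ?_
    refine (Set.infinite_range_of_injective (Nat.cast_injective (R := ℂ))).mono ?_
    rintro _ ⟨n, rfl⟩
    rw [Set.mem_ofPred_eq, ← hZ, ← spinSum_one, spinSum_diamondGraph, h]
    simp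
  rw [hZ, hpoly, h]
  simp

/-! ### The renormalization map on the real line -/

lemma renormMap_coe {q v : ℂ} (h : q + 2 * v ≠ 0) : renormMap q (v : OnePoint ℂ) =
    ((v ^ 2 * (2 * q + 4 * v + v ^ 2) / (q + 2 * v) ^ 2 : ℂ) : OnePoint ℂ) :=
  if_neg (fun h' => h h'.2)

lemma renormMap_coe_of_pole {q v : ℂ} (hv : v ≠ 0) (h : q + 2 * v = 0) :
    renormMap q (v : OnePoint ℂ) = OnePoint.infty :=
  if_pos ⟨hv, h⟩

lemma renormMap_infty (q : ℂ) : renormMap q OnePoint.infty = OnePoint.infty := rfl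

/-- The cubic whose roots are the fixed points of `F_q` other than `0` and `∞`. -/
def fixCubic (q x : ℝ) : ℝ := x ^ 3 - 2 * q * x - q ^ 2

/-- A finite limit of a real orbit is `0` or a root of the cubic. The recurrence is stated without
division, so a limit at the pole `-q / 2` is covered too. -/
lemma eq_zero_of_tendsto_orbit {q L : ℝ} {x : ℕ → ℝ}
    (hx : ∀ n, x (n + 1) * (q + 2 * x n) ^ 2 = x n ^ 2 * (2 * q + 4 * x n + x n ^ 2))
    (hL : Tendsto x atTop (𝓝 L)) : L * fixCubic q L = 0 := by
  have h1 : Tendsto (fun n => x (n + 1) * (q + 2 * x n) ^ 2) atTop (𝓝 (L * (q + 2 * L) ^ 2)) :=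
    ((tendsto_add_atTop_iff_nat 1).2 hL).mul (((hL.const_mul 2).const_add q).pow 2)
  have h2 : Tendsto (fun n => x n ^ 2 * (2 * q + 4 * x n + x n ^ 2)) atTop
      (𝓝 (L ^ 2 * (2 * q + 4 * L + L ^ 2))) :=
    (hL.pow 2).mul (((hL.const_mul 4).const_add (2 * q)).add (hL.pow 2))
  simp_rw [hx] at h1
  have := tendsto_nhds_unique h1 h2
  unfold fixCubic
  linear_combination -this

lemma orbit_sub_mul {q x y : ℝ} (h : y * (q + 2 * x) ^ 2 = x ^ 2 * (2 * q + 4 * x + x ^ 2)) :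
    (y - x) * (q + 2 * x) ^ 2 = x * fixCubic q x := by
  unfold fixCubic
  linear_combination h

/-- Where the cubic is negative, `F_q` moves real points towards `0`: an orbit decreases while it is
positive and increases once it is nonpositive. -/
lemma tendsto_zero_of_fixCubic_neg {q a b : ℝ} {x : ℕ → ℝ}
    (hx : ∀ n, x (n + 1) * (q + 2 * x n) ^ 2 = x n ^ 2 * (2 * q + 4 * x n + x n ^ 2))
    (hmem : ∀ n, x n ∈ Set.Icc a b) (hf : ∀ y ∈ Set.Icc a b, fixCubic q y < 0)
    (hneg : ∀ n, x n ≤ 0 → x (n + 1) ≤ 0) (hpole : ∀ n, q + 2 * x n ≠ 0) :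
    Tendsto x atTop (𝓝 0) := by
  suffices h : ∃ L, Tendsto x atTop (𝓝 L) by
    obtain ⟨L, hL⟩ := h
    have h1 := eq_zero_of_tendsto_orbit hx hL
    have h2 := hf L (isClosed_Icc.mem_of_tendsto hL (Eventually.of_forall hmem))
    obtain rfl : L = 0 := (mul_eq_zero.1 h1).resolve_right h2.ne
    exact hL
  by_cases hpos : ∀ n, 0 < x n
  · have hanti : Antitone x := antitone_nat_of_succ_le fun n => by
      have h1 := orbit_sub_mul (hx n)
      have h2 : x n * fixCubic q (x n) < 0 := mul_neg_of_pos_of_neg (hpos n) (hf _ (hmem n))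
      by_contra! h3
      have : 0 ≤ (x (n + 1) - x n) * (q + 2 * x n) ^ 2 :=
        mul_nonneg (by linarith) (sq_nonneg _)
      linarith
    exact ⟨_, tendsto_atTop_ciInf hanti ⟨a, by rintro _ ⟨n, rfl⟩; exact (hmem n).1⟩⟩
  · push Not at hpos
    obtain ⟨k, hk⟩ := hpos
    have hle : ∀ n, x (n + k) ≤ 0 := fun n => by
      induction n with
      | zero => simpa using hk
      | succ n ih => rw [add_right_comm]; exact hneg _ ih
    have hmono : Monotone (fun n => x (n + k)) := monotone_nat_of_le_succ fun n => by
      have h1 := orbit_sub_mul (hx (n + k))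
      have h2 : 0 ≤ x (n + k) * fixCubic q (x (n + k)) :=
        mul_nonneg_of_nonpos_of_nonpos (hle n) (hf _ (hmem _)).le
      have h3 : 0 < (q + 2 * x (n + k)) ^ 2 := by have := hpole (n + k); positivity
      rw [add_right_comm]
      by_contra! h4
      have := mul_neg_of_neg_of_pos (sub_neg.2 h4) h3
      linarith
    obtain ⟨L, hL⟩ : ∃ L, Tendsto (fun n => x (n + k)) atTop (𝓝 L) :=
      ⟨_, tendsto_atTop_ciSup hmono ⟨0, by rintro _ ⟨n, rfl⟩; exact hle n⟩⟩
    exact ⟨L, (tendsto_add_atTop_iff_nat k).1 hL⟩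

/-- `F_q` on the real line, with the junk value `0` at the pole `x = -q / 2`. -/
noncomputable def realRenorm (q x : ℝ) : ℝ := x ^ 2 * (2 * q + 4 * x + x ^ 2) / (q + 2 * x) ^ 2

lemma realRenorm_mul {q x : ℝ} (h : q + 2 * x ≠ 0) :
    realRenorm q x * (q + 2 * x) ^ 2 = x ^ 2 * (2 * q + 4 * x + x ^ 2) :=
  div_mul_cancel₀ _ (pow_ne_zero 2 h)

lemma renormMap_ofReal {q x : ℝ} (h : q + 2 * x ≠ 0) :
    renormMap (q : ℂ) ((x : ℂ) : OnePoint ℂ) = ((realRenorm q x : ℂ) : OnePoint ℂ) := by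
  rw [renormMap_coe (by exact_mod_cast h)]
  unfold realRenorm
  push_cast
  rfl

lemma qMinus_lt_qPlus {v₀ : ℝ} (hv₀ : 0 < v₀) : qMinus v₀ < qPlus v₀ := by
  have : 0 < Real.sqrt (1 + v₀) := Real.sqrt_pos.2 (by linarith)
  unfold qMinus qPlus
  nlinarith

lemma fixCubic_eq {v₀ : ℝ} (hv₀ : 0 < v₀) (q : ℝ) :
    fixCubic q v₀ = -((q - qMinus v₀) * (q - qPlus v₀)) := by
  have : Real.sqrt (1 + v₀) ^ 2 = 1 + v₀ := Real.sq_sqrt (by linarith)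
  unfold fixCubic qMinus qPlus
  linear_combination (-v₀ ^ 2) * this

lemma qPlus_pos {v₀ : ℝ} (hv₀ : 0 < v₀) : 0 < qPlus v₀ := by
  have : 1 < Real.sqrt (1 + v₀) := by
    rw [Real.lt_sqrt] <;> linarith
  exact mul_pos (by linarith) hv₀

lemma qMinus_lt {v₀ : ℝ} (hv₀ : 0 < v₀) : qMinus v₀ < -2 * v₀ := by
  have : 1 < Real.sqrt (1 + v₀) := by
    rw [Real.lt_sqrt] <;> linarith
  unfold qMinus
  nlinarith

/-- For `q < q₋` the orbit stays in `[-1, v₀]`, since `1 + F_q(x) = (1 + x² / (q + 2x))² ≥ 0`; for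
`q > q₊` it stays in `[0, v₀]`. -/
lemma tendsto_realRenorm_zero {v₀ : ℝ} (hv₀ : 0 < v₀) {q : ℝ}
    (hq : q < qMinus v₀ ∨ qPlus v₀ < q) :
    (∀ n, q + 2 * (realRenorm q)^[n] v₀ ≠ 0) ∧
      Tendsto (fun n => (realRenorm q)^[n] v₀) atTop (𝓝 0) := by
  have hf0 : fixCubic q v₀ < 0 := by
    rw [fixCubic_eq hv₀, neg_lt_zero]
    have := qMinus_lt_qPlus hv₀
    rcases hq with hq | hq
    · exact mul_pos_of_neg_of_neg (by linarith) (by linarith)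
    · exact mul_pos (by linarith) (by linarith)
  rcases hq with hq | hq
  · have hqv : q + 2 * v₀ < 0 := by have := qMinus_lt hv₀; linarith
    have hq0 : q < 0 := by linarith
    have hf : ∀ y ∈ Set.Icc (-1) v₀, fixCubic q y < 0 := by
      rintro y ⟨h1, h2⟩
      unfold fixCubic at hf0 ⊢
      rcases le_or_gt y 0 with hy | hy
      · have : y ^ 3 ≤ 0 := by
          have := mul_nonneg (sq_nonneg y) (neg_nonneg.2 hy)
          nlinarith
        have := mul_nonneg_of_nonpos_of_nonpos hq0.le hy
        nlinarith [pow_pos (neg_pos.2 hq0) 2]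
      · have : y ^ 3 ≤ v₀ ^ 3 := pow_le_pow_left₀ hy.le h2 3
        nlinarith
    have hpole : ∀ y ∈ Set.Icc (-1) v₀, q + 2 * y ≠ 0 := by
      rintro y ⟨h1, h2⟩
      have : q + 2 * y < 0 := by linarith
      exact this.ne
    have hnp : ∀ y ∈ Set.Icc (-1) v₀, y ≤ 0 → realRenorm q y ≤ 0 := by
      rintro y ⟨h1, h2⟩ hy
      refine div_nonpos_of_nonpos_of_nonneg ?_ (sq_nonneg _)
      refine mul_nonpos_of_nonneg_of_nonpos (sq_nonneg _) ?_
      nlinarith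
    have hge : ∀ y ∈ Set.Icc (-1) v₀, -1 ≤ realRenorm q y := by
      rintro y hy
      have h := hpole y hy
      rw [realRenorm, le_div_iff₀ (by positivity)]
      nlinarith [sq_nonneg (y ^ 2 + q + 2 * y)]
    have hmap : ∀ y ∈ Set.Icc (-1) v₀, realRenorm q y ∈ Set.Icc (-1) v₀ := by
      intro y hy
      refine ⟨hge y hy, ?_⟩
      rcases le_or_gt y 0 with hy0 | hy0
      · exact (hnp y hy hy0).trans hv₀.le
      · have h1 := orbit_sub_mul (realRenorm_mul (hpole y hy))
        have h2 := mul_neg_of_pos_of_neg hy0 (hf y hy)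
        by_contra! h3
        have := mul_nonneg (sub_nonneg.2 (hy.2.trans h3.le)) (sq_nonneg (q + 2 * y))
        linarith
    have hmem : ∀ n, (realRenorm q)^[n] v₀ ∈ Set.Icc (-1) v₀ := by
      intro n
      induction n with
      | zero => exact ⟨by simp; linarith, le_rfl⟩
      | succ n ih => rw [Function.iterate_succ_apply']; exact hmap _ ih
    refine ⟨fun n => hpole _ (hmem n), tendsto_zero_of_fixCubic_neg (fun n => ?_) hmem hf
      (fun n hn => ?_) (fun n => hpole _ (hmem n))⟩
    · rw [Function.iterate_succ_apply']; exact realRenorm_mul (hpole _ (hmem n))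
    · rw [Function.iterate_succ_apply']; exact hnp _ (hmem n) hn
  · have hq0 : 0 < q := (qPlus_pos hv₀).trans hq
    have hf : ∀ y ∈ Set.Icc 0 v₀, fixCubic q y < 0 := by
      rintro y ⟨h1, h2⟩
      unfold fixCubic at hf0 ⊢
      rcases le_or_gt (y ^ 2) (2 * q) with hy | hy
      · have := mul_nonneg h1 (sub_nonneg.2 hy)
        nlinarith [pow_pos hq0 2]
      · have h3 : y ^ 2 ≤ v₀ ^ 2 := pow_le_pow_left₀ h1 h2 2
        have := mul_le_mul h2 (sub_le_sub_right h3 (2 * q)) (by linarith) hv₀.le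
        linarith
    have hpole : ∀ y ∈ Set.Icc 0 v₀, q + 2 * y ≠ 0 := by
      rintro y ⟨h1, h2⟩
      positivity
    have hnp : ∀ y ∈ Set.Icc 0 v₀, y ≤ 0 → realRenorm q y ≤ 0 := by
      rintro y ⟨h1, h2⟩ hy
      obtain rfl : y = 0 := le_antisymm hy h1
      simp [realRenorm]
    have hmap : ∀ y ∈ Set.Icc 0 v₀, realRenorm q y ∈ Set.Icc 0 v₀ := by
      intro y hy
      refine ⟨by have := hy.1; unfold realRenorm; positivity, ?_⟩
      rcases le_or_gt y 0 with hy0 | hy0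
      · exact (hnp y hy hy0).trans hv₀.le
      · have h1 := orbit_sub_mul (realRenorm_mul (hpole y hy))
        have h2 := mul_neg_of_pos_of_neg hy0 (hf y hy)
        by_contra! h3
        have := mul_nonneg (sub_nonneg.2 (hy.2.trans h3.le)) (sq_nonneg (q + 2 * y))
        linarith
    have hmem : ∀ n, (realRenorm q)^[n] v₀ ∈ Set.Icc 0 v₀ := by
      intro n
      induction n with
      | zero => exact ⟨hv₀.le, le_rfl⟩
      | succ n ih => rw [Function.iterate_succ_apply']; exact hmap _ ih
    refine ⟨fun n => hpole _ (hmem n), tendsto_zero_of_fixCubic_neg (fun n => ?_) hmem hf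
      (fun n hn => ?_) (fun n => hpole _ (hmem n))⟩
    · rw [Function.iterate_succ_apply']; exact realRenorm_mul (hpole _ (hmem n))
    · rw [Function.iterate_succ_apply']; exact hnp _ (hmem n) hn

lemma mem_basinLocus_zero {v₀ : ℝ} (hv₀ : 0 < v₀) {q : ℝ}
    (hq : q < qMinus v₀ ∨ qPlus v₀ < q) :
    (q : ℂ) ∈ basinLocus ((0 : ℂ) : OnePoint ℂ) (v₀ : ℂ) := by
  obtain ⟨hpole, hlim⟩ := tendsto_realRenorm_zero hv₀ hq
  have h : ∀ n, (renormMap (q : ℂ))^[n] ((v₀ : ℂ) : OnePoint ℂ) =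
      (((realRenorm q)^[n] v₀ : ℝ) : ℂ) := by
    intro n
    induction n with
    | zero => rfl
    | succ n ih =>
      rw [Function.iterate_succ_apply', ih, renormMap_ofReal (hpole n),
        Function.iterate_succ_apply']
  change Tendsto _ _ _
  simp_rw [h]
  have h1 : Tendsto (fun n => (((realRenorm q)^[n] v₀ : ℝ) : ℂ)) atTop (𝓝 0) :=
    (Complex.continuous_ofReal.tendsto' 0 0 rfl).comp hlim
  exact (OnePoint.continuous_coe.tendsto _).comp h1

lemma fixCubic_pos_of_le {v₀ : ℝ} (hv₀ : 0 < v₀) {q : ℝ} (h1 : qMinus v₀ < q)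
    (h2 : q < qPlus v₀) {x : ℝ} (hx : v₀ ≤ x) : 0 < fixCubic q x := by
  have hf0 : 0 < fixCubic q v₀ := by
    rw [fixCubic_eq hv₀]
    nlinarith [mul_pos (sub_pos.2 h1) (sub_pos.2 h2)]
  unfold fixCubic at hf0 ⊢
  rcases le_or_gt q 0 with hq | hq
  · have : v₀ ^ 3 ≤ x ^ 3 := pow_le_pow_left₀ hv₀.le hx 3
    nlinarith [mul_nonneg (neg_nonneg.2 hq) (sub_nonneg.2 hx)]
  · have h3 : v₀ ^ 2 ≤ x ^ 2 := pow_le_pow_left₀ hv₀.le hx 2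
    have h4 : 0 < v₀ ^ 2 - 2 * q := by
      have : 0 < v₀ * (v₀ ^ 2 - 2 * q) := by nlinarith [pow_pos hq 2]
      exact pos_of_mul_pos_right this hv₀.le
    have := mul_le_mul hx (sub_le_sub_right h3 (2 * q)) h4.le (hv₀.le.trans hx)
    linarith

/-- For `q₋ < q < q₊` the orbit of `v₀` increases along the real line unless it hits the pole. -/
lemma renormMap_iterate_cases {v₀ : ℝ} (hv₀ : 0 < v₀) {q : ℝ} (h1 : qMinus v₀ < q)
    (h2 : q < qPlus v₀) (n : ℕ) :
    (renormMap (q : ℂ))^[n] ((v₀ : ℂ) : OnePoint ℂ) = OnePoint.infty ∨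
    ∃ x : ℝ, v₀ ≤ x ∧ (renormMap (q : ℂ))^[n] ((v₀ : ℂ) : OnePoint ℂ) = ((x : ℂ) : OnePoint ℂ) := by
  induction n with
  | zero => exact Or.inr ⟨v₀, le_rfl, rfl⟩
  | succ n ih =>
    rw [Function.iterate_succ_apply']
    rcases ih with h | ⟨x, hx, h⟩
    · left; rw [h]; rfl
    · rw [h]
      by_cases hp : q + 2 * x = 0
      · left
        refine renormMap_coe_of_pole ?_ (by exact_mod_cast hp)
        exact_mod_cast (hv₀.trans_le hx).ne'
      · right
        refine ⟨_, ?_, renormMap_ofReal hp⟩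
        have h3 := orbit_sub_mul (realRenorm_mul hp)
        have h4 := mul_pos (hv₀.trans_le hx) (fixCubic_pos_of_le hv₀ h1 h2 hx)
        rw [← h3] at h4
        have := pos_of_mul_pos_left h4 (sq_nonneg _)
        linarith

lemma mem_basinLocus_infty {v₀ : ℝ} (hv₀ : 0 < v₀) {q : ℝ} (h1 : qMinus v₀ < q)
    (h2 : q < qPlus v₀) : (q : ℂ) ∈ basinLocus OnePoint.infty (v₀ : ℂ) := by
  change Tendsto _ _ _
  by_cases hex : ∃ k, (renormMap (q : ℂ))^[k] ((v₀ : ℂ) : OnePoint ℂ) = OnePoint.infty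
  · obtain ⟨k, hk⟩ := hex
    refine tendsto_const_nhds.congr' ?_
    filter_upwards [eventually_ge_atTop k] with m hm
    induction m, hm using Nat.le_induction with
    | base => exact hk.symm
    | succ m _ ih => rw [Function.iterate_succ_apply', ← ih]; rfl
  · push Not at hex
    have h := fun n => (renormMap_iterate_cases hv₀ h1 h2 n).resolve_left (hex n)
    choose x hx hxe using h
    have hpole : ∀ n, q + 2 * x n ≠ 0 := by
      intro n hn
      refine hex (n + 1) ?_
      rw [Function.iterate_succ_apply', hxe]
      refine renormMap_coe_of_pole ?_ (by exact_mod_cast hn)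
      exact_mod_cast (hv₀.trans_le (hx n)).ne'
    have hrec : ∀ n, x (n + 1) = realRenorm q (x n) := by
      intro n
      have := hxe (n + 1)
      rw [Function.iterate_succ_apply', hxe, renormMap_ofReal (hpole n),
        OnePoint.coe_eq_coe] at this
      exact_mod_cast this.symm
    have hrec' : ∀ n, x (n + 1) * (q + 2 * x n) ^ 2 = x n ^ 2 * (2 * q + 4 * x n + x n ^ 2) :=
      fun n => by rw [hrec]; exact realRenorm_mul (hpole n)
    have hmono : Monotone x := monotone_nat_of_le_succ fun n => by
      have h3 := orbit_sub_mul (hrec' n)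
      have h4 := mul_pos (hv₀.trans_le (hx n)) (fixCubic_pos_of_le hv₀ h1 h2 (hx n))
      rw [← h3] at h4
      have := pos_of_mul_pos_left h4 (sq_nonneg _)
      linarith
    have hlim : Tendsto x atTop atTop := by
      rcases tendsto_atTop_of_monotone hmono with h | ⟨L, hL⟩
      · exact h
      · exfalso
        have hLv : v₀ ≤ L := ge_of_tendsto' hL hx
        have := mul_pos (hv₀.trans_le hLv) (fixCubic_pos_of_le hv₀ h1 h2 hLv)
        exact this.ne' (eq_zero_of_tendsto_orbit hrec' hL)
    simp_rw [hxe]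
    refine (OnePoint.tendsto_coe_infty (X := ℂ)).comp ?_
    rw [coclosedCompact_eq_cocompact, ← Metric.cobounded_eq_cocompact,
      ← tendsto_norm_atTop_iff_cobounded]
    refine tendsto_atTop_mono (fun n => ?_) hlim
    simpa using le_abs_self (x n)

/-! ### Zero-free neighbourhoods -/

/-- The pair `x` consists of homogeneous coordinates of the point `w` of the Riemann sphere. -/
def IsHomogeneousCoord (w : OnePoint ℂ) (x : ℂ × ℂ) : Prop :=
  (w = OnePoint.infty ∧ x.2 = 0 ∧ x.1 ≠ 0) ∨
    ∃ v : ℂ, w = (v : OnePoint ℂ) ∧ x.2 ≠ 0 ∧ x.1 = v * x.2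

/-- The excluded case `q = w = 0` is the point of indeterminacy of the homogeneous map. -/
lemma IsHomogeneousCoord.potStep {q : ℂ} {w : OnePoint ℂ} {x : ℂ × ℂ}
    (h : IsHomogeneousCoord w x) (h0 : q ≠ 0 ∨ w ≠ ((0 : ℂ) : OnePoint ℂ)) :
    IsHomogeneousCoord (renormMap q w) (potStep q x) := by
  obtain ⟨N, D⟩ := x
  rcases h with ⟨rfl, h2, h1⟩ | ⟨v, rfl, h2, h1⟩
  · left
    simp only at h1 h2
    subst h2
    simpa [_root_.potStep, renormMap_infty] using h1
  · simp only at h1 h2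
    subst h1
    by_cases hp : q + 2 * v = 0
    · have hv : v ≠ 0 := by
        rintro rfl
        rcases h0 with h0 | h0
        · exact h0 (by simpa using hp)
        · exact h0 rfl
      left
      obtain rfl : q = -2 * v := by linear_combination hp
      refine ⟨renormMap_coe_of_pole hv hp, ?_, ?_⟩
      · simp only [_root_.potStep]; ring
      · simp only [_root_.potStep]
        rw [show (v * D) ^ 2 * (2 * (-2 * v) * D ^ 2 + 4 * (v * D) * D + (v * D) ^ 2) =
          v ^ 4 * D ^ 4 by ring]
        positivity
    · right
      refine ⟨_, renormMap_coe hp, ?_, ?_⟩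
      · simp only [_root_.potStep]
        rw [show (D * (q * D + 2 * (v * D))) ^ 2 = D ^ 4 * (q + 2 * v) ^ 2 by ring]
        positivity
      · simp only [_root_.potStep]
        rw [div_mul_eq_mul_div, eq_div_iff (pow_ne_zero 2 hp)]
        ring

lemma isHomogeneousCoord_iterate {q v : ℂ}
    (h0 : ∀ n, q ≠ 0 ∨ (renormMap q)^[n] (v : OnePoint ℂ) ≠ ((0 : ℂ) : OnePoint ℂ)) (n : ℕ) :
    IsHomogeneousCoord ((renormMap q)^[n] (v : OnePoint ℂ)) ((potStep q)^[n] (v, 1)) := by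
  induction n with
  | zero => exact Or.inr ⟨v, rfl, by simp⟩
  | succ n ih =>
    rw [Function.iterate_succ_apply', Function.iterate_succ_apply']
    exact ih.potStep (h0 n)

lemma continuous_iterate_potStep (v : ℂ) (m : ℕ) :
    Continuous fun q => (potStep q)^[m] (v, 1) := by
  obtain ⟨P, Q, h⟩ := exists_polynomial_iterate_potStep v m
  simp_rw [h]
  fun_prop

/-- The disc `|v| ≤ δ` is mapped into itself, uniformly for `c ≤ |z| ≤ 4c`. -/
lemma potStep_trap_zero {c δ : ℝ} (hδ : 0 < δ) (hδ1 : δ ≤ 1) (hδc : δ ≤ c / 64)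
    {z : ℂ} (hz1 : c ≤ ‖z‖) (hz2 : ‖z‖ ≤ 4 * c) {x : ℂ × ℂ} (hx : ‖x.1‖ ≤ δ * ‖x.2‖)
    (hx0 : x.2 ≠ 0) : ‖(potStep z x).1‖ ≤ δ * ‖(potStep z x).2‖ ∧ (potStep z x).2 ≠ 0 := by
  obtain ⟨N, D⟩ := x
  simp only at hx hx0
  have hD : 0 < ‖D‖ := norm_pos_iff.2 hx0
  have hc : 0 < c := by linarith
  have h1 : c / 2 * ‖D‖ ≤ ‖z * D + 2 * N‖ := by
    have h2 : ‖z * D‖ - ‖2 * N‖ ≤ ‖z * D + 2 * N‖ := by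
      simpa using norm_sub_norm_le (z * D) (-(2 * N))
    rw [norm_mul, norm_mul, Complex.norm_ofNat] at h2
    nlinarith
  have h3 : ‖2 * z * D ^ 2 + 4 * N * D + N ^ 2‖ ≤ (8 * c + 4 * δ + δ ^ 2) * ‖D‖ ^ 2 := by
    refine (norm_add₃_le).trans ?_
    simp only [norm_mul, norm_pow, Complex.norm_ofNat]
    have h4 : ‖N‖ * ‖D‖ ≤ δ * ‖D‖ * ‖D‖ := mul_le_mul_of_nonneg_right hx hD.le
    have h5 : ‖N‖ ^ 2 ≤ (δ * ‖D‖) ^ 2 := pow_le_pow_left₀ (norm_nonneg _) hx 2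
    have h6 : ‖z‖ * ‖D‖ ^ 2 ≤ 4 * c * ‖D‖ ^ 2 := mul_le_mul_of_nonneg_right hz2 (by positivity)
    nlinarith
  have h7 : (c / 2 * ‖D‖ ^ 2) ^ 2 ≤ ‖(potStep z (N, D)).2‖ := by
    simp only [potStep, norm_pow, norm_mul]
    refine pow_le_pow_left₀ (by positivity) ?_ 2
    nlinarith
  refine ⟨?_, norm_pos_iff.1 (lt_of_lt_of_le (by positivity) h7)⟩
  refine le_trans ?_ (mul_le_mul_of_nonneg_left h7 hδ.le)
  have h8 : ‖N‖ ^ 2 ≤ (δ * ‖D‖) ^ 2 := pow_le_pow_left₀ (norm_nonneg _) hx 2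
  simp only [potStep, norm_mul, norm_pow]
  refine (mul_le_mul h8 h3 (norm_nonneg _) (by positivity)).trans ?_
  have h9 : δ * (8 * c + 4 * δ + δ ^ 2) ≤ c ^ 2 / 4 := by
    have : δ ^ 2 ≤ δ := by nlinarith
    nlinarith
  have := mul_le_mul_of_nonneg_right h9 (show 0 ≤ δ * ‖D‖ ^ 4 by positivity)
  nlinarith

/-- The disc `|v| ≥ 1 / δ` about `∞` is mapped into itself, uniformly for `|z| ≤ C`. -/
lemma potStep_trap_infty {C δ : ℝ} (hC : 1 ≤ C) (hδ : δ = 1 / (16 * C))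
    {z : ℂ} (hz : ‖z‖ ≤ C) {x : ℂ × ℂ} (hx : ‖x.2‖ ≤ δ * ‖x.1‖)
    (hx0 : x.1 ≠ 0) : ‖(potStep z x).2‖ ≤ δ * ‖(potStep z x).1‖ ∧ (potStep z x).1 ≠ 0 := by
  obtain ⟨N, D⟩ := x
  simp only at hx hx0
  have hN : 0 < ‖N‖ := norm_pos_iff.2 hx0
  have hδ0 : 0 < δ := by rw [hδ]; positivity
  have hCδ : C * δ = 1 / 16 := by rw [hδ]; field_simp
  have hδ1 : δ ≤ 1 / 16 := by nlinarith
  have hzD : ‖z‖ * ‖D‖ ≤ 1 / 16 * ‖N‖ := by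
    rw [← hCδ, mul_assoc]
    exact mul_le_mul hz hx (norm_nonneg _) (by linarith)
  have hD : ‖D‖ ≤ 1 / 16 * ‖N‖ := hx.trans (by gcongr)
  have h1 : 1 / 2 * ‖N‖ ^ 2 ≤ ‖2 * z * D ^ 2 + 4 * N * D + N ^ 2‖ := by
    have h2 : ‖N ^ 2‖ - ‖2 * z * D ^ 2 + 4 * N * D‖ ≤ ‖2 * z * D ^ 2 + 4 * N * D + N ^ 2‖ := by
      have := norm_sub_norm_le (N ^ 2) (-(2 * z * D ^ 2 + 4 * N * D))
      rw [norm_neg, sub_neg_eq_add, add_comm (N ^ 2)] at this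
      exact this
    have h3 : ‖2 * z * D ^ 2 + 4 * N * D‖ ≤ 2 * (‖z‖ * ‖D‖) * ‖D‖ + 4 * ‖N‖ * ‖D‖ := by
      refine (norm_add_le _ _).trans (le_of_eq ?_)
      simp only [norm_mul, norm_pow, Complex.norm_ofNat]
      ring
    rw [norm_pow] at h2
    have h4 := mul_le_mul hzD hD (norm_nonneg _) (by positivity)
    nlinarith
  have h5 : 1 / 2 * ‖N‖ ^ 4 ≤ ‖(potStep z (N, D)).1‖ := by
    simp only [potStep, norm_pow, norm_mul]
    nlinarith [pow_pos hN 2]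
  refine ⟨?_, norm_pos_iff.1 (lt_of_lt_of_le (by positivity) h5)⟩
  refine le_trans ?_ (mul_le_mul_of_nonneg_left h5 hδ0.le)
  have h6 : ‖z * D + 2 * N‖ ≤ 33 / 16 * ‖N‖ := by
    refine (norm_add_le _ _).trans ?_
    simp only [norm_mul, Complex.norm_ofNat]
    linarith
  simp only [potStep, norm_mul, norm_pow]
  have h7 : (‖D‖ * ‖z * D + 2 * N‖) ^ 2 ≤ ((δ * ‖N‖) * (33 / 16 * ‖N‖)) ^ 2 := by gcongr
  refine h7.trans ?_
  have := mul_le_mul_of_nonneg_right hδ1 (show 0 ≤ δ * ‖N‖ ^ 4 by positivity)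
  nlinarith [pow_pos hN 4]

/-- Some neighbourhood of `q` contains no zero of `Z(D_m, ·, v₀)` other than `0` for all large
`m`. -/
def EventuallyZeroFree (v₀ q : ℂ) : Prop :=
  ∃ U ∈ 𝓝 q, ∀ᶠ m in atTop, ∀ z ∈ U, pottsZ (diamondGraph m) z v₀ = 0 → z = 0

lemma eventuallyZeroFree_of_eventually {v₀ q : ℂ} {M : ℕ}
    (h : ∀ᶠ z in 𝓝 q, ∀ m ≥ M, pottsZ (diamondGraph m) z v₀ = 0 → z = 0) :
    EventuallyZeroFree v₀ q := by
  obtain ⟨U, hU, h⟩ := h.exists_mem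
  exact ⟨U, hU, (eventually_ge_atTop M).mono fun m hm z hz => h z hz m hm⟩

lemma eventuallyZeroFree_of_basin_zero {v₀ q : ℂ} (hq : q ≠ 0)
    (h : q ∈ basinLocus ((0 : ℂ) : OnePoint ℂ) v₀) : EventuallyZeroFree v₀ q := by
  set c := ‖q‖ / 2 with hc
  have hc0 : 0 < c := by positivity
  set δ := min 1 (c / 64) with hδ
  have hδ0 : 0 < δ := by positivity
  have hδ1 : δ ≤ 1 := min_le_left _ _
  have hδc : δ ≤ c / 64 := min_le_right _ _
  have hU : (↑) '' Metric.ball (0 : ℂ) δ ∈ 𝓝 ((0 : ℂ) : OnePoint ℂ) := by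
    rw [OnePoint.nhds_coe_eq]
    exact image_mem_map (Metric.ball_mem_nhds _ hδ0)
  obtain ⟨M, v, hv, hvM⟩ := (Tendsto.eventually h hU).exists
  have hstart : ‖((potStep q)^[M] (v₀, 1)).1‖ < δ * ‖((potStep q)^[M] (v₀, 1)).2‖ := by
    rcases isHomogeneousCoord_iterate (q := q) (v := v₀) (fun _ => Or.inl hq) M with
      ⟨h1, -⟩ | ⟨v', h1, h2, h3⟩
    · rw [← hvM] at h1; exact absurd h1 (OnePoint.coe_ne_infty v)
    · rw [← hvM, OnePoint.coe_eq_coe] at h1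
      subst h1
      rw [h3, norm_mul]
      exact mul_lt_mul_of_pos_right (by simpa using hv) (norm_pos_iff.2 h2)
  have hcont := continuous_iterate_potStep v₀ M
  have e1 := (hcont.fst.norm.tendsto q).eventually_lt
    ((hcont.snd.norm.const_mul δ).tendsto q) hstart
  have e2 : ∀ᶠ z in 𝓝 q, c < ‖z‖ := continuous_norm.tendsto q |>.eventually_const_lt (by linarith)
  have e3 : ∀ᶠ z in 𝓝 q, ‖z‖ < 4 * c :=
    continuous_norm.tendsto q |>.eventually_lt_const (by linarith)
  refine eventuallyZeroFree_of_eventually (M := M) ?_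
  filter_upwards [e1, e2, e3] with z hz1 hz2 hz3 m hm hZ
  have key : ∀ m ≥ M, ‖((potStep z)^[m] (v₀, 1)).1‖ ≤ δ * ‖((potStep z)^[m] (v₀, 1)).2‖ ∧
      ((potStep z)^[m] (v₀, 1)).2 ≠ 0 := by
    intro m hm
    induction m, hm using Nat.le_induction with
    | base =>
      refine ⟨hz1.le, fun h0 => ?_⟩
      rw [h0, norm_zero, mul_zero] at hz1
      exact absurd hz1 (not_lt.2 (norm_nonneg _))
    | succ m _ ih =>
      rw [Function.iterate_succ_apply']
      exact potStep_trap_zero hδ0 hδ1 hδc hz2.le hz3.le ih.1 ih.2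
  obtain ⟨h2, h4⟩ := key m hm
  rw [pottsZ_diamondGraph] at hZ
  refine (mul_eq_zero.1 hZ).resolve_right fun h0 => ?_
  have h1 : ((potStep z)^[m] (v₀, 1)).1 = -(z * ((potStep z)^[m] (v₀, 1)).2) := by
    linear_combination h0
  rw [h1, norm_neg, norm_mul] at h2
  have h3 : ‖z‖ ≤ δ := le_of_mul_le_mul_right h2 (norm_pos_iff.2 h4)
  linarith

lemma eventuallyZeroFree_of_basin_infty {v₀ q : ℂ}
    (h0 : ∀ n, q ≠ 0 ∨ (renormMap q)^[n] (v₀ : OnePoint ℂ) ≠ ((0 : ℂ) : OnePoint ℂ))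
    (h : q ∈ basinLocus OnePoint.infty v₀) : EventuallyZeroFree v₀ q := by
  set C := ‖q‖ + 1 with hC
  have hC1 : 1 ≤ C := by rw [hC]; linarith [norm_nonneg q]
  obtain ⟨δ, hδ⟩ : ∃ δ : ℝ, δ = 1 / (16 * C) := ⟨_, rfl⟩
  have hδ0 : 0 < δ := by rw [hδ]; positivity
  have hCδ : C * δ = 1 / 16 := by rw [hδ]; field_simp
  have hU : ((↑) '' Metric.closedBall (0 : ℂ) δ⁻¹)ᶜ ∈ 𝓝 (OnePoint.infty : OnePoint ℂ) :=
    (OnePoint.isOpen_compl_image_coe.2 ⟨Metric.isClosed_closedBall, isCompact_closedBall _ _⟩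
      ).mem_nhds OnePoint.infty_notMem_image_coe
  obtain ⟨M, hM⟩ := (Tendsto.eventually h hU).exists
  have hstart : ‖((potStep q)^[M] (v₀, 1)).2‖ < δ * ‖((potStep q)^[M] (v₀, 1)).1‖ := by
    rcases isHomogeneousCoord_iterate h0 M with ⟨h1, h2, h3⟩ | ⟨v', h1, h2, h3⟩
    · rw [h2, norm_zero]
      have := norm_pos_iff.2 h3
      positivity
    · have hv' : δ⁻¹ < ‖v'‖ := by
        by_contra! hle
        exact hM ⟨v', by simpa using hle, h1.symm⟩
      rw [h3, norm_mul, ← mul_assoc]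
      have := norm_pos_iff.2 h2
      have h5 : 1 < δ * ‖v'‖ := by
        rwa [inv_eq_one_div, div_lt_iff₀' hδ0] at hv'
      nlinarith
  have hcont := continuous_iterate_potStep v₀ M
  have e1 := (hcont.snd.norm.tendsto q).eventually_lt
    ((hcont.fst.norm.const_mul δ).tendsto q) hstart
  have e3 : ∀ᶠ z in 𝓝 q, ‖z‖ < C := continuous_norm.tendsto q |>.eventually_lt_const (by linarith)
  refine eventuallyZeroFree_of_eventually (M := M) ?_
  filter_upwards [e1, e3] with z hz1 hz3 m hm hZ
  have key : ∀ m ≥ M, ‖((potStep z)^[m] (v₀, 1)).2‖ ≤ δ * ‖((potStep z)^[m] (v₀, 1)).1‖ ∧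
      ((potStep z)^[m] (v₀, 1)).1 ≠ 0 := by
    intro m hm
    induction m, hm using Nat.le_induction with
    | base =>
      refine ⟨hz1.le, fun h0 => ?_⟩
      rw [h0, norm_zero, mul_zero] at hz1
      exact absurd hz1 (not_lt.2 (norm_nonneg _))
    | succ m _ ih =>
      rw [Function.iterate_succ_apply']
      exact potStep_trap_infty hC1 hδ hz3.le ih.1 ih.2
  obtain ⟨h2, h4⟩ := key m hm
  rw [pottsZ_diamondGraph] at hZ
  refine (mul_eq_zero.1 hZ).resolve_right fun h0 => ?_
  have h1 : ((potStep z)^[m] (v₀, 1)).1 = -(z * ((potStep z)^[m] (v₀, 1)).2) := by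
    linear_combination h0
  have h5 := norm_pos_iff.2 h4
  have h6 : ‖((potStep z)^[m] (v₀, 1)).1‖ ≤ C * (δ * ‖((potStep z)^[m] (v₀, 1)).1‖) := by
    conv_lhs => rw [h1, norm_neg, norm_mul]
    exact mul_le_mul hz3.le h2 (norm_nonneg _) (by linarith)
  rw [← mul_assoc, hCδ] at h6
  linarith

lemma eventuallyZeroFree_of_ne {v₀ : ℝ} (hv₀ : 0 < v₀) {q : ℝ} (h1 : q ≠ qMinus v₀)
    (h2 : q ≠ qPlus v₀) : EventuallyZeroFree (v₀ : ℂ) (q : ℂ) := by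
  by_cases h : q < qMinus v₀ ∨ qPlus v₀ < q
  · refine eventuallyZeroFree_of_basin_zero ?_ (mem_basinLocus_zero hv₀ h)
    have h3 := qPlus_pos hv₀
    have h4 := qMinus_lt hv₀
    rw [Complex.ofReal_ne_zero]
    rcases h with h | h <;> intro h0 <;> linarith
  · push Not at h
    have h3 := lt_of_le_of_ne h.1 h1.symm
    have h4 := lt_of_le_of_ne h.2 h2
    refine eventuallyZeroFree_of_basin_infty (fun n => Or.inr ?_) (mem_basinLocus_infty hv₀ h3 h4)
    rcases renormMap_iterate_cases hv₀ h3 h4 n with h | ⟨x, hx, h⟩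
    · rw [h]; exact OnePoint.infty_ne_coe _
    · rw [h, Ne, OnePoint.coe_eq_coe, Complex.ofReal_eq_zero]
      linarith

lemma EventuallyZeroFree.notMem_derivedSet {v₀ q : ℂ} (h : EventuallyZeroFree v₀ q) :
    q ∉ derivedSet (zeroLimitSet v₀) := by
  obtain ⟨U, hU, h⟩ := h
  obtain ⟨V, hVU, hVo, hqV⟩ := mem_nhds_iff.1 hU
  have hsub : ∀ z ∈ V, z ∈ zeroLimitSet v₀ → z = 0 := by
    intro z hz hzL
    by_contra hz0
    have hW : V ∩ {0}ᶜ ∈ 𝓝 z := inter_mem (hVo.mem_nhds hz) (compl_singleton_mem_nhds hz0)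
    obtain ⟨m, ⟨w, ⟨hwV, hw0⟩, hw⟩, hm⟩ := ((hzL _ hW).and_eventually h).exists
    exact hw0 (hm w (hVU hwV) hw)
  intro hq
  rw [mem_derivedSet, accPt_iff_nhds] at hq
  by_cases hq0 : q = 0
  · subst hq0
    obtain ⟨y, ⟨hyV, hyL⟩, hy⟩ := hq V (hVo.mem_nhds hqV)
    exact hy (hsub y hyV hyL)
  · obtain ⟨y, ⟨⟨hyV, hy0⟩, hyL⟩, -⟩ := hq (V ∩ {0}ᶜ)
      (inter_mem (hVo.mem_nhds hqV) (compl_singleton_mem_nhds hq0))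
    exact hy0 (hsub y hyV hyL)

/-! ### Square roots and the slit plane -/
lemma complexSqrt_sq (z : ℂ) : Complex.sqrt z ^ 2 = z := Complex.cpow_ofNat_inv_pow z 2

lemma re_sqrt_nonneg (z : ℂ) : 0 ≤ (Complex.sqrt z).re := by
  rw [Complex.sqrt, Complex.cpow_inv_two_re]
  exact Real.sqrt_nonneg _

lemma re_sqrt_pos {z : ℂ} (hz : z ∈ Complex.slitPlane) : 0 < (Complex.sqrt z).re := by
  rw [Complex.sqrt, Complex.cpow_inv_two_re, Real.sqrt_pos]
  rcases hz with h | h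
  · linarith [norm_nonneg z]
  · have := (abs_lt.1 (Complex.abs_re_lt_norm.2 h)).1
    linarith

lemma analyticAt_sqrt {z : ℂ} (hz : z ∈ Complex.slitPlane) : AnalyticAt ℂ Complex.sqrt z :=
  analyticAt_id.cpow analyticAt_const hz

lemma sq_mem_slitPlane {z : ℂ} (hz : 0 < z.re) : z ^ 2 ∈ Complex.slitPlane := by
  rw [Complex.mem_slitPlane_iff, sq, Complex.mul_re, Complex.mul_im]
  by_cases h : z.im = 0
  · left; rw [h]; nlinarith
  · right
    have : z.re * z.im + z.im * z.re = 2 * (z.re * z.im) := by ring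
    rw [this]
    exact mul_ne_zero two_ne_zero (mul_ne_zero hz.ne' h)

lemma sqrt_ofReal_sq {x : ℝ} (hx : 0 < x) : Complex.sqrt ((x : ℂ) ^ 2) = x :=
  Complex.sq_cpow_two_inv (by simpa using hx)

/-- A holomorphic square root near a point where the function does not vanish, with a prescribed
value there. -/
lemma exists_analyticAt_sq_eq {h : ℂ → ℂ} {z₀ c : ℂ} (hh : AnalyticAt ℂ h z₀)
    (hc : c ^ 2 = h z₀) (hc0 : c ≠ 0) :
    ∃ r : ℂ → ℂ, AnalyticAt ℂ r z₀ ∧ r z₀ = c ∧ ∀ z, r z ^ 2 = h z := by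
  refine ⟨fun z => c * Complex.sqrt (h z / c ^ 2), ?_, ?_, fun z => ?_⟩
  · refine analyticAt_const.mul (AnalyticAt.fun_comp (analyticAt_sqrt ?_) (hh.div_const))
    rw [← hc, div_self (pow_ne_zero 2 hc0)]
    exact Complex.one_mem_slitPlane
  · simp [← hc, div_self (pow_ne_zero 2 hc0)]
  · rw [mul_pow, complexSqrt_sq]
    field_simp

/-! ### Attracting fixed points of holomorphic self-maps -/

/-- By the Schwarz lemma `|f(z) / z| < 1` throughout the disc, and so `f` contracts each smaller
concentric disc by a factor less than `1`. -/
lemma tendsto_iterate_unitBall {f : ℂ → ℂ} (hd : DifferentiableOn ℂ f (Metric.ball 0 1))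
    (hm : Set.MapsTo f (Metric.ball 0 1) (Metric.ball 0 1)) (h0 : f 0 = 0)
    (hder : ‖deriv f 0‖ < 1) {w : ℂ} (hw : w ∈ Metric.ball (0 : ℂ) 1) :
    Tendsto (fun n => f^[n] w) atTop (𝓝 0) := by
  have hm' : Set.MapsTo f (Metric.ball 0 1) (Metric.closedBall (f 0) 1) := by
    rw [h0]; exact hm.mono_right Metric.ball_subset_closedBall
  have hlt : ∀ z ∈ Metric.ball (0 : ℂ) 1, ‖dslope f 0 z‖ < 1 := by
    intro z hz
    have hle := Complex.norm_dslope_le_div_of_mapsTo_ball hd hm' hz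
    rw [div_one] at hle
    refine lt_of_le_of_ne hle fun heq => ?_
    have haff := Complex.affine_of_mapsTo_ball_of_norm_dslope_eq_div hd hm' hz
      (by rw [heq, div_one])
    have : deriv f 0 = dslope f 0 z := by
      have h1 : f =ᶠ[𝓝 0] fun x => f 0 + (x - 0) • dslope f 0 z :=
        haff.eventuallyEq_of_mem (Metric.ball_mem_nhds _ one_pos)
      rw [h1.deriv_eq]
      simp
    rw [this, heq] at hder
    exact lt_irrefl _ hder
  have hwr : ‖w‖ < 1 := by simpa using hw
  have hsub : Metric.closedBall (0 : ℂ) ‖w‖ ⊆ Metric.ball 0 1 := Metric.closedBall_subset_ball hwr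
  have hcont : ContinuousOn (dslope f 0) (Metric.ball 0 1) :=
    (continuousOn_dslope (Metric.ball_mem_nhds _ one_pos)).2
      ⟨hd.continuousOn, hd.differentiableAt (Metric.ball_mem_nhds _ one_pos)⟩
  obtain ⟨x, hx, hmax⟩ := (isCompact_closedBall (0 : ℂ) ‖w‖).exists_isMaxOn
    (Metric.nonempty_closedBall.2 (norm_nonneg w)) (hcont.norm.mono hsub)
  set k := ‖dslope f 0 x‖ with hk
  have hk1 : k < 1 := hlt x (hsub hx)
  have hstep : ∀ z ∈ Metric.closedBall (0 : ℂ) ‖w‖, ‖f z‖ ≤ k * ‖z‖ := by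
    intro z hz
    have h1 : ‖dslope f 0 z‖ ≤ k := hmax hz
    have h2 := sub_smul_dslope f 0 z
    rw [h0, sub_zero, sub_zero] at h2
    rw [← h2, norm_smul, mul_comm]
    gcongr
  have hbound : ∀ n, ‖f^[n] w‖ ≤ k ^ n * ‖w‖ := by
    intro n
    induction n with
    | zero => simp
    | succ n ih =>
      have hmem : f^[n] w ∈ Metric.closedBall (0 : ℂ) ‖w‖ := by
        rw [mem_closedBall_zero_iff]
        exact ih.trans (mul_le_of_le_one_left (norm_nonneg _) (pow_le_one₀ (norm_nonneg _) hk1.le))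
      rw [Function.iterate_succ_apply', pow_succ', mul_assoc]
      exact (hstep _ hmem).trans (by gcongr)
  refine squeeze_zero_norm hbound ?_
  simpa using (tendsto_pow_atTop_nhds_zero_of_lt_one (norm_nonneg _) hk1).mul_const ‖w‖

/-- The disc version is transported by `w ↦ v ((1 + w) / (1 - w))²`, which maps the unit disc onto
the slit plane and `0` to `v`; its inverse is `z ↦ (√z - √v) / (√z + √v)`. -/
lemma tendsto_iterate_slitPlane {g : ℂ → ℂ} (hd : DifferentiableOn ℂ g Complex.slitPlane)
    (hm : Set.MapsTo g Complex.slitPlane Complex.slitPlane) {v : ℝ} (hv : 0 < v)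
    (hfix : g v = v) (hder : ‖deriv g v‖ < 1) {x : ℂ} (hx : x ∈ Complex.slitPlane) :
    Tendsto (fun n => g^[n] x) atTop (𝓝 (v : ℂ)) := by
  obtain ⟨a, ha, rfl⟩ : ∃ a : ℝ, 0 < a ∧ v = a ^ 2 :=
    ⟨√v, Real.sqrt_pos.2 hv, (Real.sq_sqrt hv.le).symm⟩
  set p : ℂ := ((a ^ 2 : ℝ) : ℂ) with hp
  have hpa : p = (a : ℂ) ^ 2 := by rw [hp]; push_cast; rfl
  have ha0 : (a : ℂ) ≠ 0 := Complex.ofReal_ne_zero.2 ha.ne'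
  set φ : ℂ → ℂ := fun z => (Complex.sqrt z - a) / (Complex.sqrt z + a) with hφ
  set ψ : ℂ → ℂ := fun w => a ^ 2 * ((1 + w) / (1 - w)) ^ 2 with hψ
  have hpS : p ∈ Complex.slitPlane := Or.inl (by rw [hp, Complex.ofReal_re]; exact hv)
  have hsa : ∀ z, Complex.sqrt z + a ≠ 0 := fun z h => by
    have := congrArg Complex.re h
    simp only [Complex.add_re, Complex.ofReal_re, Complex.zero_re] at this
    linarith [re_sqrt_nonneg z]
  have hψφ : ∀ z, ψ (φ z) = z := by
    intro z
    have h1 := hsa z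
    have h2 : 1 - φ z = 2 * a / (Complex.sqrt z + a) := by
      simp only [hφ]; field_simp; ring
    have h3 : 1 + φ z = 2 * Complex.sqrt z / (Complex.sqrt z + a) := by
      simp only [hφ]; field_simp; ring
    have h4 : (1 + φ z) / (1 - φ z) = Complex.sqrt z / a := by
      rw [h2, h3]; field_simp
    simp only [hψ]
    rw [h4, div_pow, complexSqrt_sq]
    field_simp
  have hφm : Set.MapsTo φ Complex.slitPlane (Metric.ball 0 1) := by
    intro z hz
    have hs := re_sqrt_pos hz
    rw [mem_ball_zero_iff, norm_div, div_lt_one (norm_pos_iff.2 (hsa z))]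
    rw [← sq_lt_sq₀ (norm_nonneg _) (norm_nonneg _), Complex.sq_norm, Complex.sq_norm,
      Complex.normSq_apply, Complex.normSq_apply]
    simp only [Complex.sub_re, Complex.add_re, Complex.sub_im, Complex.add_im, Complex.ofReal_re,
      Complex.ofReal_im]
    nlinarith [mul_pos hs ha]
  have hne : ∀ w ∈ Metric.ball (0 : ℂ) 1, 1 - w ≠ 0 := by
    intro w hw h
    rw [← sub_eq_zero.1 h] at hw
    simp at hw
  have hψm : Set.MapsTo ψ (Metric.ball 0 1) Complex.slitPlane := by
    intro w hw
    have h1 := hne w hw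
    have h2 : 0 < ((1 + w) / (1 - w)).re := by
      rw [Complex.div_re, ← add_div]
      refine div_pos ?_ (Complex.normSq_pos.2 h1)
      have h3 : w.re * w.re + w.im * w.im < 1 := by
        rw [← Complex.normSq_apply, ← Complex.sq_norm]
        rw [mem_ball_zero_iff] at hw
        exact pow_lt_one₀ (norm_nonneg _) hw two_ne_zero
      simp only [Complex.add_re, Complex.sub_re, Complex.one_re, Complex.add_im, Complex.sub_im,
        Complex.one_im]
      nlinarith
    have h4 : ψ w = (a * ((1 + w) / (1 - w))) ^ 2 := by simp only [hψ]; ring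
    rw [h4]
    refine sq_mem_slitPlane ?_
    rw [Complex.re_ofReal_mul]
    exact mul_pos ha h2
  have hφd : ∀ z ∈ Complex.slitPlane, DifferentiableAt ℂ φ z := fun z hz =>
    ((Complex.differentiableAt_sqrt hz).sub_const _).div
      ((Complex.differentiableAt_sqrt hz).add_const _) (hsa z)
  have hψd : ∀ w ∈ Metric.ball (0 : ℂ) 1, DifferentiableAt ℂ ψ w := fun w hw =>
    (((differentiableAt_id.const_add 1).div (differentiableAt_id.const_sub 1) (hne w hw)).pow
      2).const_mul _
  have hψ0 : ψ 0 = p := by simp [hψ, hpa]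
  have hφp : φ p = 0 := by
    simp only [hφ]
    rw [hpa, sqrt_ofReal_sq ha, sub_self, zero_div]
  have h0mem : (0 : ℂ) ∈ Metric.ball (0 : ℂ) 1 := Metric.mem_ball_self one_pos
  have hgd : DifferentiableAt ℂ g p :=
    hd.differentiableAt (Complex.isOpen_slitPlane.mem_nhds hpS)
  set f : ℂ → ℂ := fun w => φ (g (ψ w)) with hf
  have hf0 : f 0 = 0 := by simp only [hf]; rw [hψ0, hfix, hφp]
  have hfd : DifferentiableOn ℂ f (Metric.ball 0 1) := fun w hw => by
    have e1 : DifferentiableAt ℂ (g ∘ ψ) w := DifferentiableAt.comp w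
      (hd.differentiableAt (Complex.isOpen_slitPlane.mem_nhds (hψm hw))) (hψd w hw)
    exact (DifferentiableAt.comp (f := g ∘ ψ) w (hφd _ (hm (hψm hw))) e1).differentiableWithinAt
  have hfm : Set.MapsTo f (Metric.ball 0 1) (Metric.ball 0 1) := fun w hw => hφm (hm (hψm hw))
  have hfder : deriv f 0 = deriv g p := by
    have e1 : HasDerivAt φ (deriv φ p) p := (hφd p hpS).hasDerivAt
    have e2 : HasDerivAt ψ (deriv ψ 0) 0 := (hψd 0 h0mem).hasDerivAt
    have e3 : HasDerivAt g (deriv g p) p := hgd.hasDerivAt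
    have e4 : HasDerivAt (fun w => g (ψ w)) (deriv g p * deriv ψ 0) 0 :=
      HasDerivAt.comp 0 (by rw [hψ0]; exact e3) e2
    have e5 : HasDerivAt f (deriv φ p * (deriv g p * deriv ψ 0)) 0 :=
      HasDerivAt.comp 0 (h₂ := φ) (by rw [hψ0, hfix]; exact e1) e4
    have e6 : HasDerivAt (fun z => ψ (φ z)) (deriv ψ 0 * deriv φ p) p :=
      HasDerivAt.comp p (h₂ := ψ) (by rw [hφp]; exact e2) e1
    have e7 : deriv ψ 0 * deriv φ p = 1 := by
      simp_rw [hψφ] at e6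
      exact e6.unique (hasDerivAt_id p)
    rw [e5.deriv]
    linear_combination deriv g p * e7
  have hconj : ∀ n, φ (g^[n] x) = f^[n] (φ x) := by
    intro n
    induction n with
    | zero => rfl
    | succ n ih =>
      rw [Function.iterate_succ_apply', Function.iterate_succ_apply', ← ih]
      simp only [hf, hψφ]
  have hlim := tendsto_iterate_unitBall hfd hfm hf0 (by rw [hfder]; exact hder) (hφm hx)
  have hlim2 := ((hψd 0 h0mem).continuousAt.tendsto).comp hlim
  rw [hψ0] at hlim2
  refine hlim2.congr fun n => ?_
  rw [Function.comp_apply, ← hconj, hψφ]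

/-! ### Inverse branches of the renormalization map -/

/-- The relation `F_q(a) = b` with the denominator cleared. -/
def RenormRel (q a b : ℂ) : Prop := a ^ 2 * (2 * q + 4 * a + a ^ 2) = b * (q + 2 * a) ^ 2

/-- The renormalization map is the composition of the series reduction `u = a² / (q + 2a)` of two
edges and the parallel reduction `1 + b = (1 + u)²` of two series pairs. -/
lemma RenormRel.of_series {q a b u : ℂ} (h : a ^ 2 = u * (q + 2 * a)) (hb : b = u ^ 2 + 2 * u) :
    RenormRel q a b := by
  unfold RenormRel
  rw [hb]
  linear_combination (2 * q + 4 * a + a ^ 2 + u * (q + 2 * a)) * h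

/-- An inverse branch `G q` of `F_q` which, at `q = q₀`, is a self-map of the slit plane fixing
`v₀`. It is holomorphic jointly in `q` and `v` near the points of the slit plane at `q = q₀`. -/
structure InverseBranch (q₀ : ℂ) (v₀ : ℝ) (G : ℂ → ℂ → ℂ) : Prop where
  analyticAt : ∀ v ∈ Complex.slitPlane, AnalyticAt ℂ (fun z : ℂ × ℂ => G z.1 z.2) (q₀, v)
  rel : ∀ q v, RenormRel q (G q v) v
  mapsTo : Set.MapsTo (G q₀) Complex.slitPlane Complex.slitPlane
  fixed : G q₀ v₀ = v₀

lemma add_ofReal_mem_slitPlane {z : ℂ} (hz : z ∈ Complex.slitPlane) {x : ℝ} (hx : 0 ≤ x) :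
    z + x ∈ Complex.slitPlane := by
  rw [Complex.mem_slitPlane_iff] at hz ⊢
  rcases hz with h | h
  · left; simp; linarith
  · right; simpa using h

lemma analyticAt_sqrt_comp {E : Type*} [NormedAddCommGroup E] [NormedSpace ℂ E] {f : E → ℂ} {x : E}
    (hf : AnalyticAt ℂ f x) (h : f x ∈ Complex.slitPlane) :
    AnalyticAt ℂ (fun y => Complex.sqrt (f y)) x :=
  AnalyticAt.fun_comp (analyticAt_sqrt h) hf

lemma mem_slitPlane_of_ne {z : ℂ} (h : ∀ x : ℝ, x ≤ 0 → z ≠ x) : z ∈ Complex.slitPlane := by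
  rw [Complex.mem_slitPlane_iff]
  by_contra! h'
  exact h z.re h'.1 (Complex.ext rfl (by simpa using h'.2))

lemma ofReal_mem_slitPlane_of_pos {x : ℝ} (h : 0 < x) : (x : ℂ) ∈ Complex.slitPlane :=
  Or.inl (by simpa using h)

lemma ofReal_notMem_slitPlane {x : ℝ} (h : x ≤ 0) : (x : ℂ) ∉ Complex.slitPlane := by
  rw [Complex.mem_slitPlane_iff]; simp [h]

/-- The inverse branch at `q₀ = q₊`: with `u = √(1 + v) - 1` it is `u + √u √(u + q)`. -/
lemma exists_inverseBranch_pos {σ : ℝ} (hσ : 1 < σ) :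
    ∃ G, InverseBranch (((σ - 1) ^ 2 * (σ + 1) : ℝ) : ℂ) (σ ^ 2 - 1) G := by
  set q₀ : ℝ := (σ - 1) ^ 2 * (σ + 1) with hq₀
  have hq : 0 < q₀ := by have := sub_pos.2 hσ; positivity
  set u : ℂ → ℂ := fun v => Complex.sqrt (1 + v) - 1 with hu
  have hone : ∀ v ∈ Complex.slitPlane, 1 + v ∈ Complex.slitPlane := fun v hv => by
    simpa [add_comm] using add_ofReal_mem_slitPlane hv zero_le_one
  have huS : ∀ v ∈ Complex.slitPlane, u v ∈ Complex.slitPlane := by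
    intro v hv
    refine mem_slitPlane_of_ne fun x hx h => ?_
    have h1 : Complex.sqrt (1 + v) = (1 + x : ℝ) := by
      push_cast; rw [← h]; simp [hu]
    have h2 : 0 < 1 + x := by
      have := re_sqrt_pos (hone v hv)
      rwa [h1, Complex.ofReal_re] at this
    have h3 : v = ((x * (2 + x) : ℝ) : ℂ) := by
      have := complexSqrt_sq (1 + v)
      rw [h1] at this
      push_cast at this ⊢
      linear_combination -this
    rw [h3] at hv
    exact ofReal_notMem_slitPlane (mul_nonpos_of_nonpos_of_nonneg hx (by linarith)) hv
  have huq : ∀ v ∈ Complex.slitPlane, u v + q₀ ∈ Complex.slitPlane := fun v hv =>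
    add_ofReal_mem_slitPlane (huS v hv) hq.le
  have hseries : ∀ q v : ℂ, (u v + Complex.sqrt (u v) * Complex.sqrt (u v + q)) ^ 2 =
      u v * (q + 2 * (u v + Complex.sqrt (u v) * Complex.sqrt (u v + q))) := by
    intro q v
    have h1 := complexSqrt_sq (u v)
    have h2 := complexSqrt_sq (u v + q)
    linear_combination Complex.sqrt (u v + q) ^ 2 * h1 + u v * h2
  have huu : ∀ v : ℂ, v = u v ^ 2 + 2 * u v := fun v => by
    have := complexSqrt_sq (1 + v)
    simp only [hu]
    linear_combination -this
  refine ⟨fun q v => u v + Complex.sqrt (u v) * Complex.sqrt (u v + q), ?_, ?_, ?_, ?_⟩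
  · intro v hv
    have e1 : AnalyticAt ℂ (fun z : ℂ × ℂ => u z.2) ((q₀ : ℂ), v) :=
      (analyticAt_sqrt_comp (analyticAt_const.add analyticAt_snd) (hone v hv)).sub analyticAt_const
    exact e1.add ((analyticAt_sqrt_comp e1 (huS v hv)).mul
      (analyticAt_sqrt_comp (e1.add analyticAt_fst) (huq v hv)))
  · exact fun q v => RenormRel.of_series (hseries q v) (huu v)
  · intro v hv
    refine mem_slitPlane_of_ne fun x hx h => ?_
    have h1 := hseries q₀ v
    simp only at h
    rw [h] at h1
    have h2 : q₀ + 2 * x ≠ 0 := by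
      intro h0
      have h3 : (x : ℂ) ^ 2 = 0 := by
        rw [h1, show (q₀ : ℂ) + 2 * x = ((q₀ + 2 * x : ℝ) : ℂ) by push_cast; rfl, h0]
        simp
      have h4 : x = 0 := by exact_mod_cast pow_eq_zero_iff two_ne_zero |>.1 h3
      rw [h4] at h0
      linarith
    have h3 : u v = ((x ^ 2 / (q₀ + 2 * x) : ℝ) : ℂ) := by
      push_cast
      rw [h1, mul_div_cancel_right₀]
      exact_mod_cast h2
    have h4 : 0 < x ^ 2 / (q₀ + 2 * x) := by
      have := huS v hv
      rw [h3] at this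
      by_contra! h5
      exact ofReal_notMem_slitPlane h5 this
    set y := x ^ 2 / (q₀ + 2 * x) with hy
    rw [h3, show (y : ℂ) + q₀ = ((y + q₀ : ℝ) : ℂ) by push_cast; rfl,
      Complex.sqrt_of_nonneg (by exact_mod_cast h4.le),
      Complex.sqrt_of_nonneg (by exact_mod_cast (add_pos h4 hq).le), Complex.ofReal_re,
      Complex.ofReal_re] at h
    have h6 : y + √y * √(y + q₀) = x := by exact_mod_cast h
    have : 0 ≤ √y * √(y + q₀) := by positivity
    linarith
  · have h1 : u ((σ ^ 2 - 1 : ℝ) : ℂ) = ((σ - 1 : ℝ) : ℂ) := by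
      simp only [hu]
      rw [show (1 : ℂ) + ((σ ^ 2 - 1 : ℝ) : ℂ) = (σ : ℂ) ^ 2 by push_cast; ring,
        sqrt_ofReal_sq (by linarith)]
      push_cast; rfl
    have h2 : ((σ - 1 : ℝ) : ℂ) + q₀ = (((σ - 1) * σ ^ 2 : ℝ) : ℂ) := by
      rw [hq₀]; push_cast; ring
    have h3 : 0 ≤ σ - 1 := by linarith
    rw [h1, h2, Complex.sqrt_of_nonneg (by exact_mod_cast h3),
      Complex.sqrt_of_nonneg (by exact_mod_cast (by positivity : 0 ≤ (σ - 1) * σ ^ 2)),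
      Complex.ofReal_re, Complex.ofReal_re, Real.sqrt_mul h3, Real.sqrt_sq (by linarith)]
    have := Real.mul_self_sqrt h3
    norm_cast
    linear_combination σ * this

/-- The inverse branch at `q₀ = q₋`: with `A = 1 + √(1 + v)` and `τ = √(1 - q / A)` it is
`-q / (1 + τ) = A (τ - 1)`, the solution for `u = -A`. -/
lemma exists_inverseBranch_neg {σ : ℝ} (hσ : σ < -1) :
    ∃ G, InverseBranch (((σ - 1) ^ 2 * (σ + 1) : ℝ) : ℂ) (σ ^ 2 - 1) G := by
  set q₀ : ℝ := (σ - 1) ^ 2 * (σ + 1) with hq₀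
  have hq : q₀ < 0 := by
    have : 0 < (σ - 1) ^ 2 := by nlinarith
    exact mul_neg_of_pos_of_neg this (by linarith)
  set A : ℂ → ℂ := fun v => 1 + Complex.sqrt (1 + v) with hA
  set τ : ℂ → ℂ → ℂ := fun q v => Complex.sqrt (1 - q / A v) with hτ
  have hone : ∀ v ∈ Complex.slitPlane, 1 + v ∈ Complex.slitPlane := fun v hv => by
    simpa [add_comm] using add_ofReal_mem_slitPlane hv zero_le_one
  have hAre : ∀ v, 0 < (A v).re := fun v => by
    have := re_sqrt_nonneg (1 + v)
    simp only [hA, Complex.add_re, Complex.one_re]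
    linarith
  have hA0 : ∀ v, A v ≠ 0 := fun v h => by
    have := hAre v
    rw [h] at this
    simp at this
  have hτre : ∀ q v, 0 < (1 + τ q v).re := fun q v => by
    have := re_sqrt_nonneg (1 - q / A v)
    simp only [hτ, Complex.add_re, Complex.one_re]
    linarith
  have hτ0 : ∀ q v, 1 + τ q v ≠ 0 := fun q v h => by
    have := hτre q v
    rw [h] at this
    simp at this
  have hτS : ∀ v, 1 - q₀ / A v ∈ Complex.slitPlane := by
    intro v
    left
    have h1 : ((q₀ : ℂ) / A v).re ≤ 0 := by
      rw [div_eq_mul_inv, Complex.re_ofReal_mul, Complex.inv_re]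
      exact mul_nonpos_of_nonpos_of_nonneg hq.le (div_nonneg (hAre v).le (Complex.normSq_nonneg _))
    simp only [Complex.sub_re, Complex.one_re]
    linarith
  have hG : ∀ q v, -q / (1 + τ q v) = A v * (τ q v - 1) := by
    intro q v
    rw [div_eq_iff (hτ0 q v)]
    have h1 := complexSqrt_sq (1 - q / A v)
    have h2 : A v * (q / A v) = q := mul_div_cancel₀ q (hA0 v)
    change τ q v ^ 2 = _ at h1
    linear_combination -A v * h1 + h2
  refine ⟨fun q v => -q / (1 + τ q v), ?_, ?_, ?_, ?_⟩
  · intro v hv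
    have e1 : AnalyticAt ℂ (fun z : ℂ × ℂ => A z.2) ((q₀ : ℂ), v) :=
      analyticAt_const.add
        (analyticAt_sqrt_comp (analyticAt_const.add analyticAt_snd) (hone v hv))
    have e2 : AnalyticAt ℂ (fun z : ℂ × ℂ => τ z.1 z.2) ((q₀ : ℂ), v) :=
      analyticAt_sqrt_comp (analyticAt_const.sub (analyticAt_fst.div e1 (hA0 v))) (hτS v)
    exact analyticAt_fst.neg.div (analyticAt_const.add e2) (hτ0 _ v)
  · intro q v
    refine RenormRel.of_series (u := -A v) ?_ ?_
    · have h1 := complexSqrt_sq (1 - q / A v)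
      have h2 : A v * (q / A v) = q := mul_div_cancel₀ q (hA0 v)
      change τ q v ^ 2 = _ at h1
      rw [hG]
      linear_combination A v ^ 2 * h1 - A v * h2
    · have := complexSqrt_sq (1 + v)
      simp only [hA]
      linear_combination -this
  · intro v _
    left
    have h1 : -(q₀ : ℂ) / (1 + τ q₀ v) = ((-q₀ : ℝ) : ℂ) * (1 + τ q₀ v)⁻¹ := by
      push_cast; rw [div_eq_mul_inv]
    simp only
    rw [h1, Complex.re_ofReal_mul, Complex.inv_re]
    exact mul_pos (by linarith) (div_pos (hτre _ _) (Complex.normSq_pos.2 (hτ0 _ _)))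
  · have h1 : A ((σ ^ 2 - 1 : ℝ) : ℂ) = ((1 - σ : ℝ) : ℂ) := by
      simp only [hA]
      rw [show (1 : ℂ) + ((σ ^ 2 - 1 : ℝ) : ℂ) = ((-σ : ℝ) : ℂ) ^ 2 by push_cast; ring,
        sqrt_ofReal_sq (by linarith)]
      push_cast; ring
    have h2 : τ q₀ ((σ ^ 2 - 1 : ℝ) : ℂ) = ((-σ : ℝ) : ℂ) := by
      simp only [hτ]
      rw [h1]
      have h3 : (((1 - σ : ℝ)) : ℂ) ≠ 0 := by
        rw [Complex.ofReal_ne_zero]; linarith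
      rw [show (1 : ℂ) - q₀ / ((1 - σ : ℝ) : ℂ) = ((-σ : ℝ) : ℂ) ^ 2 by
        rw [sub_eq_iff_eq_add, ← sub_eq_iff_eq_add', eq_div_iff h3, hq₀]; push_cast; ring]
      exact sqrt_ofReal_sq (by linarith)
    rw [hG, h1, h2]
    push_cast
    ring

/-- No nondegeneracy is needed: if the orbit degenerates to `(0, 0)`, the conclusion is trivial, and
the partition function vanishes as well. -/
lemma RenormRel.potStep {q a b : ℂ} (h : RenormRel q a b) {x : ℂ × ℂ} (hx : x.1 = a * x.2) :
    (potStep q x).1 = b * (potStep q x).2 := by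
  unfold RenormRel at h
  simp only [_root_.potStep, hx]
  linear_combination x.2 ^ 4 * h

lemma iterate_potStep_of_rel {q : ℂ} {g : ℂ → ℂ} (hg : ∀ v, RenormRel q (g v) v) {a : ℂ} (n : ℕ)
    {x : ℂ × ℂ} (hx : x.1 = g^[n] a * x.2) :
    ((potStep q)^[n] x).1 = a * ((potStep q)^[n] x).2 := by
  induction n generalizing x with
  | zero => exact hx
  | succ n ih =>
    rw [Function.iterate_succ_apply]
    refine ih ?_
    rw [Function.iterate_succ_apply'] at hx
    exact (hg _).potStep hx

/-! ### Hurwitz' theorem -/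

/-- A consequence of the maximum principle for `1 / f`. -/
lemma exists_zero_of_norm_lt {f : ℂ → ℂ} {z₀ : ℂ} {r : ℝ} (hr : 0 < r)
    (hf : DiffContOnCl ℂ f (Metric.ball z₀ r)) (h : ∀ z ∈ Metric.sphere z₀ r, ‖f z₀‖ < ‖f z‖) :
    ∃ z ∈ Metric.closedBall z₀ r, f z = 0 := by
  by_contra! hne
  have hcont : ContinuousOn f (Metric.closedBall z₀ r) := by
    rw [← closure_ball z₀ hr.ne']; exact hf.continuousOn
  obtain ⟨w, hw, hmin⟩ := (isCompact_sphere z₀ r).exists_isMinOn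
    (NormedSpace.sphere_nonempty.2 hr.le) (hcont.mono Metric.sphere_subset_closedBall).norm
  have hinv : DiffContOnCl ℂ f⁻¹ (Metric.ball z₀ r) :=
    hf.inv (fun z hz => hne z (by rwa [closure_ball z₀ hr.ne'] at hz))
  have h1 : ‖f⁻¹ z₀‖ ≤ ‖f w‖⁻¹ := by
    refine Complex.norm_le_of_forall_mem_frontier_norm_le Metric.isBounded_ball hinv
      (fun z hz => ?_) (subset_closure (Metric.mem_ball_self hr))
    rw [frontier_ball z₀ hr.ne'] at hz
    rw [Pi.inv_apply, norm_inv]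
    exact inv_anti₀ (norm_pos_iff.2 (hne w (Metric.sphere_subset_closedBall hw))) (hmin hz)
  rw [Pi.inv_apply, norm_inv] at h1
  have h2 := inv_strictAnti₀ (norm_pos_iff.2 (hne z₀ (Metric.mem_closedBall_self hr.le))) (h w hw)
  linarith

/-- Hurwitz' theorem: an isolated zero of a uniform limit is a limit of zeros. -/
lemma eventually_exists_zero {F : ℕ → ℂ → ℂ} {f : ℂ → ℂ} {z₀ : ℂ} {U : Set ℂ} (hU : U ∈ 𝓝 z₀)
    (hF : ∀ n, DifferentiableOn ℂ (F n) U) (hlim : TendstoUniformlyOn F f atTop U)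
    (h0 : f z₀ = 0) (hne : ∀ᶠ z in 𝓝[≠] z₀, f z ≠ 0) :
    ∀ᶠ n in atTop, ∃ z ∈ U, F n z = 0 := by
  rw [eventually_nhdsWithin_iff] at hne
  obtain ⟨r, hr, hball⟩ := Metric.nhds_basis_closedBall.mem_iff.1 (inter_mem hU hne)
  have hfc : ContinuousOn f U :=
    hlim.continuousOn (Frequently.of_forall fun n => (hF n).continuousOn)
  have hsub : Metric.closedBall z₀ r ⊆ U := fun z hz => (hball hz).1
  have hss : Metric.sphere z₀ r ⊆ Metric.closedBall z₀ r := Metric.sphere_subset_closedBall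
  obtain ⟨w, hw, hmin⟩ := (isCompact_sphere z₀ r).exists_isMinOn
    (NormedSpace.sphere_nonempty.2 hr.le) (hfc.mono (hss.trans hsub)).norm
  have hw0 : 0 < ‖f w‖ := norm_pos_iff.2 ((hball (hss hw)).2 (by
    rintro rfl
    simp at hw
    exact hr.ne hw))
  have hclose := Metric.tendstoUniformlyOn_iff.1 hlim (‖f w‖ / 2) (by positivity)
  filter_upwards [hclose] with n hn
  have h1 : ‖F n z₀‖ < ‖f w‖ / 2 := by
    have := hn z₀ (hsub (Metric.mem_closedBall_self hr.le))
    rwa [h0, dist_eq_norm, zero_sub, norm_neg] at this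
  obtain ⟨z, hz, hz0⟩ := exists_zero_of_norm_lt (f := F n) hr
    (((hF n).mono (hsub.trans' (closure_ball z₀ hr.ne').subset)).diffContOnCl) (fun z hz => by
      have h2 := hn z (hsub (hss hz))
      rw [dist_eq_norm] at h2
      have h3 : ‖f w‖ ≤ ‖f z‖ := hmin hz
      have h4 := norm_sub_norm_le (f z) (F n z)
      linarith)
  exact ⟨z, hsub hz, hz0⟩

/-! ### The local dynamics of the inverse branch -/

namespace InverseBranch

variable {σ : ℝ} {G : ℂ → ℂ → ℂ}

lemma differentiableAt {q₀ : ℂ} {v₀ : ℝ} (hG : InverseBranch q₀ v₀ G) {v : ℂ}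
    (hv : v ∈ Complex.slitPlane) : DifferentiableAt ℂ (G q₀) v :=
  ((hG.analyticAt v hv).comp₂ analyticAt_const analyticAt_id).differentiableAt

/-- The multiplier is `(σ + 1)² / (4σ²)`, found by differentiating the defining relation of `G`. -/
lemma norm_deriv_lt_one (hG : InverseBranch (((σ - 1) ^ 2 * (σ + 1) : ℝ) : ℂ) (σ ^ 2 - 1) G)
    (hσ : 1 < |σ|) : ‖deriv (G (((σ - 1) ^ 2 * (σ + 1) : ℝ) : ℂ)) ((σ ^ 2 - 1 : ℝ) : ℂ)‖ < 1 := by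
  set q : ℂ := (((σ - 1) ^ 2 * (σ + 1) : ℝ) : ℂ) with hq
  set v : ℂ := ((σ ^ 2 - 1 : ℝ) : ℂ) with hv
  have hσ2 : 1 < σ ^ 2 := by rw [← sq_abs]; nlinarith
  have hvS : v ∈ Complex.slitPlane := ofReal_mem_slitPlane_of_pos (by linarith)
  have hd := (hG.differentiableAt hvS).hasDerivAt
  set g := deriv (G q) v with hg
  have h1 : HasDerivAt (fun w => G q w ^ 2 * (2 * q + 4 * G q w + G q w ^ 2) -
      w * (q + 2 * G q w) ^ 2)
      ((2 * G q v * g) * (2 * q + 4 * G q v + G q v ^ 2) + G q v ^ 2 * (4 * g + 2 * G q v * g) -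
      (1 * (q + 2 * G q v) ^ 2 + v * (2 * (q + 2 * G q v) * (2 * g)))) v := by
    have e2 : HasDerivAt (fun w => G q w ^ 2) (2 * G q v * g) v := by
      simpa using hd.fun_pow 2
    have e3 : HasDerivAt (fun w => (q + 2 * G q w) ^ 2) (2 * (q + 2 * G q v) * (2 * g)) v := by
      simpa using ((hd.const_mul 2).const_add q).fun_pow 2
    exact (e2.mul (((hd.const_mul 4).const_add (2 * q)).add e2)).sub ((hasDerivAt_id v).mul e3)
  have h2 : (fun w => G q w ^ 2 * (2 * q + 4 * G q w + G q w ^ 2) -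
      w * (q + 2 * G q w) ^ 2) = fun _ => 0 := by
    funext w
    exact sub_eq_zero.2 (hG.rel q w)
  rw [h2] at h1
  have h3 := h1.unique (hasDerivAt_const v (0 : ℂ))
  rw [hG.fixed] at h3
  have hv0 : v ≠ 0 := Complex.slitPlane_ne_zero hvS
  have h4 : (4 * σ ^ 2 : ℂ) * g = (σ + 1) ^ 2 := by
    have : v ^ 2 * ((4 * σ ^ 2 : ℂ) * g) = v ^ 2 * (σ + 1) ^ 2 := by
      rw [hq, hv] at *
      push_cast at h3 ⊢
      linear_combination h3
    exact mul_left_cancel₀ (pow_ne_zero 2 hv0) this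
  have h5 : 4 * σ ^ 2 * ‖g‖ = (σ + 1) ^ 2 := by
    have := congrArg norm h4
    rw [norm_mul, show (4 * σ ^ 2 : ℂ) = ((4 * σ ^ 2 : ℝ) : ℂ) by push_cast; rfl,
      show ((σ : ℂ) + 1) ^ 2 = (((σ + 1) ^ 2 : ℝ) : ℂ) by push_cast; rfl, Complex.norm_real,
      Complex.norm_real, Real.norm_of_nonneg (by positivity), Real.norm_of_nonneg (by positivity)]
      at this
    exact this
  have h6 : (σ + 1) ^ 2 < 4 * σ ^ 2 := by
    have : σ ≤ |σ| := le_abs_self σ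
    have h7 := sq_abs σ
    nlinarith
  by_contra! h7
  nlinarith

lemma tendsto_iterate (hG : InverseBranch (((σ - 1) ^ 2 * (σ + 1) : ℝ) : ℂ) (σ ^ 2 - 1) G)
    (hσ : 1 < |σ|) {x : ℂ} (hx : x ∈ Complex.slitPlane) :
    Tendsto (fun n => (G (((σ - 1) ^ 2 * (σ + 1) : ℝ) : ℂ))^[n] x) atTop
      (𝓝 ((σ ^ 2 - 1 : ℝ) : ℂ)) :=
  tendsto_iterate_slitPlane (fun _ hv => (hG.differentiableAt hv).differentiableWithinAt)
    hG.mapsTo (by rw [← sq_abs]; nlinarith) hG.fixed (hG.norm_deriv_lt_one hσ) hx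

lemma analyticAt_iterate {q₀ : ℂ} {v₀ : ℝ} (hG : InverseBranch q₀ v₀ G) {x : ℂ}
    (hx : x ∈ Complex.slitPlane) (n : ℕ) :
    AnalyticAt ℂ (fun z : ℂ × ℂ => (G z.1)^[n] z.2) (q₀, x) := by
  induction n with
  | zero => exact analyticAt_snd
  | succ n ih =>
    simp_rw [Function.iterate_succ_apply']
    exact (hG.analyticAt _ (hG.mapsTo.iterate n hx)).comp₂ analyticAt_fst ih

/-- Near `v₀` the branches `G q`, for `q` near `q₀`, contract by a common factor. -/
lemma exists_contraction {q₀ : ℂ} {v₀ : ℝ} (hG : InverseBranch q₀ v₀ G) (hv₀ : 0 < v₀)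
    (hd : ‖deriv (G q₀) v₀‖ < 1) :
    ∃ k, 0 ≤ k ∧ k < 1 ∧ ∃ r > 0, ∀ q ∈ Metric.ball q₀ r, ∀ x ∈ Metric.ball (v₀ : ℂ) r,
      AnalyticAt ℂ (fun z : ℂ × ℂ => G z.1 z.2) (q, x) ∧
      ∀ y ∈ Metric.ball (v₀ : ℂ) r, ‖G q x - G q y‖ ≤ k * ‖x - y‖ := by
  have hv : (v₀ : ℂ) ∈ Complex.slitPlane := ofReal_mem_slitPlane_of_pos hv₀
  have ha := hG.analyticAt _ hv
  set L := fderiv ℂ (fun z : ℂ × ℂ => G z.1 z.2) (q₀, (v₀ : ℂ)) with hL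
  have hstrict : HasStrictFDerivAt (fun z : ℂ × ℂ => G z.1 z.2) L (q₀, (v₀ : ℂ)) :=
    ha.hasStrictFDerivAt
  have hL1 : deriv (G q₀) v₀ = L (0, 1) := by
    have h1 : HasDerivAt (fun v : ℂ => (q₀, v)) (0, 1) (v₀ : ℂ) :=
      (hasDerivAt_const _ _).prodMk (hasDerivAt_id _)
    exact (hstrict.hasFDerivAt.comp_hasDerivAt (v₀ : ℂ) h1).deriv
  set d := ‖deriv (G q₀) v₀‖ with hdd
  have hε : 0 < (1 - d) / 2 := by linarith
  have hlo := (hstrict.isLittleO.def hε)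
  rw [nhds_prod_eq] at hlo
  have hev : ∀ᶠ z : ℂ × ℂ in 𝓝 (q₀, (v₀ : ℂ)), AnalyticAt ℂ (fun z : ℂ × ℂ => G z.1 z.2) z :=
    ha.eventually_analyticAt
  obtain ⟨s, hs, hlo⟩ := (eventually_prod_self_iff (r := fun p₁ p₂ : ℂ × ℂ =>
    ‖G p₁.1 p₁.2 - G p₂.1 p₂.2 - L (p₁ - p₂)‖ ≤ (1 - d) / 2 * ‖p₁ - p₂‖)).1 hlo
  obtain ⟨r, hr, hball⟩ := Metric.nhds_basis_ball.mem_iff.1 (inter_mem hs hev)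
  have hmem : ∀ q ∈ Metric.ball q₀ r, ∀ x ∈ Metric.ball (v₀ : ℂ) r,
      (q, x) ∈ Metric.ball (q₀, (v₀ : ℂ)) r := fun q hq x hx => by
    rw [← ball_prod_same]; exact ⟨hq, hx⟩
  refine ⟨d + (1 - d) / 2, by positivity, by linarith, r, hr, fun q hq x hx =>
    ⟨(hball (hmem q hq x hx)).2, fun y hy => ?_⟩⟩
  have h1 := hlo (q, x) (hball (hmem q hq x hx)).1 (q, y) (hball (hmem q hq y hy)).1
  have h2 : ((q, x) : ℂ × ℂ) - (q, y) = (x - y) • ((0, 1) : ℂ × ℂ) := by simp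
  rw [h2, map_smul, ← hL1, norm_smul] at h1
  simp only [smul_eq_mul] at h1
  have h3 : ‖((0, 1) : ℂ × ℂ)‖ = 1 := by simp [Prod.norm_def]
  rw [h3, mul_one] at h1
  have h4 := norm_sub_le_norm_sub_add_norm_sub (G q x - G q y) ((x - y) * deriv (G q₀) v₀) 0
  rw [sub_zero, sub_zero, norm_mul] at h4
  linarith

end InverseBranch

/-! ### The parameter curve -/

/-- The parameter `q` as an entire function of the uniformizing variable `t`. -/
noncomputable def qParam (t : ℂ) : ℂ := Complex.sin t ^ 2 * (2 + Complex.sin t)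

/-- A fixed point of `F_q` for `q = qParam t`. -/
noncomputable def pParam (t : ℂ) : ℂ := Complex.sin t * (2 + Complex.sin t)

lemma renormRel_pParam (t : ℂ) : RenormRel (qParam t) (pParam t) (pParam t) := by
  refine RenormRel.of_series (u := Complex.sin t) ?_ ?_ <;> unfold pParam <;> try unfold qParam
  all_goals ring

lemma analyticAt_complexSin (t : ℂ) : AnalyticAt ℂ Complex.sin t :=
  Complex.differentiable_sin.analyticAt t

lemma analyticAt_qParam (t : ℂ) : AnalyticAt ℂ qParam t :=
  ((analyticAt_complexSin t).fun_pow 2).fun_mul (analyticAt_const.fun_add (analyticAt_complexSin t))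

lemma analyticAt_pParam (t : ℂ) : AnalyticAt ℂ pParam t :=
  (analyticAt_complexSin t).fun_mul (analyticAt_const.fun_add (analyticAt_complexSin t))

lemma qParam_eq {σ : ℝ} {t : ℂ} (h : Complex.sin t = σ - 1) :
    qParam t = (((σ - 1) ^ 2 * (σ + 1) : ℝ) : ℂ) := by
  unfold qParam; rw [h]; push_cast; ring

lemma pParam_eq {σ : ℝ} {t : ℂ} (h : Complex.sin t = σ - 1) :
    pParam t = ((σ ^ 2 - 1 : ℝ) : ℂ) := by
  unfold pParam; rw [h]; push_cast; ring

lemma differentiable_iterate_potStep_fst (v : ℂ) (m : ℕ) :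
    Differentiable ℂ fun q => ((potStep q)^[m] (v, 1)).1 := by
  obtain ⟨P, Q, h⟩ := exists_polynomial_iterate_potStep v m
  simp_rw [h]
  exact P.differentiable

lemma differentiable_iterate_potStep_snd (v : ℂ) (m : ℕ) :
    Differentiable ℂ fun q => ((potStep q)^[m] (v, 1)).2 := by
  obtain ⟨P, Q, h⟩ := exists_polynomial_iterate_potStep v m
  simp_rw [h]
  exact Q.differentiable

lemma iterate_potStep_zero_pos {v : ℝ} (hv : 0 < v) (m : ℕ) :
    ∃ N D : ℝ, 0 < N ∧ 0 < D ∧ (potStep 0)^[m] ((v : ℂ), 1) = ((N : ℂ), (D : ℂ)) := by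
  induction m with
  | zero => exact ⟨v, 1, hv, one_pos, by simp⟩
  | succ m ih =>
    obtain ⟨N, D, hN, hD, h⟩ := ih
    refine ⟨N ^ 2 * (4 * N * D + N ^ 2), (D * (2 * N)) ^ 2, by positivity, by positivity, ?_⟩
    rw [Function.iterate_succ_apply', h]
    simp [potStep]

namespace InverseBranch

variable {σ : ℝ} {G : ℂ → ℂ → ℂ}

/-- `G (pParam t)` and `pParam t` are both mapped to `pParam t` by `F_q`, and they are near `v₀`,
where `F_q` is injective: the difference of the two relations factors, and the second factor equals
`4v₀²(1 + v₀)` at `t₀`. -/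
lemma eventually_fixed (hG : InverseBranch (((σ - 1) ^ 2 * (σ + 1) : ℝ) : ℂ) (σ ^ 2 - 1) G)
    (hσ : 1 < |σ|) {t₀ : ℂ} (ht₀ : Complex.sin t₀ = σ - 1) :
    ∀ᶠ t in 𝓝 t₀, G (qParam t) (pParam t) = pParam t := by
  have hσ2 : 1 < σ ^ 2 := by rw [← sq_abs]; nlinarith
  have hv : ((σ ^ 2 - 1 : ℝ) : ℂ) ∈ Complex.slitPlane :=
    ofReal_mem_slitPlane_of_pos (by linarith)
  have hg : ContinuousAt (fun t => G (qParam t) (pParam t)) t₀ := by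
    refine (AnalyticAt.comp₂ (h := fun z : ℂ × ℂ => G z.1 z.2) ?_ (analyticAt_qParam t₀)
      (analyticAt_pParam t₀)).continuousAt
    rw [qParam_eq ht₀, pParam_eq ht₀]
    exact hG.analyticAt _ hv
  have hq := (analyticAt_qParam t₀).continuousAt
  have hp := (analyticAt_pParam t₀).continuousAt
  -- The quotient of the difference of the two relations by `G (qParam t) (pParam t) - pParam t`.
  set H : ℂ → ℂ := fun t => (G (qParam t) (pParam t) + pParam t) *
      (G (qParam t) (pParam t) ^ 2 + pParam t ^ 2) +
      4 * (G (qParam t) (pParam t) ^ 2 + G (qParam t) (pParam t) * pParam t + pParam t ^ 2) +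
      2 * qParam t * (G (qParam t) (pParam t) + pParam t) -
      4 * pParam t * (qParam t + G (qParam t) (pParam t) + pParam t) with hH
  have hHc : ContinuousAt H t₀ :=
    ((((hg.add hp).mul ((hg.pow 2).add (hp.pow 2))).add
      (((hg.pow 2).add (hg.mul hp)).add (hp.pow 2) |>.const_mul 4)).add
      ((hq.const_mul 2).mul (hg.add hp))).sub ((hp.const_mul 4).mul ((hq.add hg).add hp))
  have hH0 : H t₀ ≠ 0 := by
    simp only [hH]
    rw [qParam_eq ht₀, pParam_eq ht₀, hG.fixed]
    norm_cast
    have : (σ ^ 2 - 1 + (σ ^ 2 - 1)) * ((σ ^ 2 - 1) ^ 2 + (σ ^ 2 - 1) ^ 2) +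
          4 * ((σ ^ 2 - 1) ^ 2 + (σ ^ 2 - 1) * (σ ^ 2 - 1) + (σ ^ 2 - 1) ^ 2) +
        2 * ((σ - 1) ^ 2 * (σ + 1)) * (σ ^ 2 - 1 + (σ ^ 2 - 1)) -
      4 * (σ ^ 2 - 1) * ((σ - 1) ^ 2 * (σ + 1) + (σ ^ 2 - 1) + (σ ^ 2 - 1)) =
      4 * (σ ^ 2 - 1) ^ 2 * σ ^ 2 := by ring
    rw [this]
    have : 0 < σ ^ 2 - 1 := by linarith
    positivity
  filter_upwards [hHc.eventually_ne hH0] with t ht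
  have h1 := hG.rel (qParam t) (pParam t)
  have h2 := renormRel_pParam t
  unfold RenormRel at h1 h2
  have h3 : (G (qParam t) (pParam t) - pParam t) * H t = 0 := by
    simp only [hH]
    linear_combination h1 - h2
  exact sub_eq_zero.1 ((mul_eq_zero.1 h3).resolve_right ht)

/-- Near `t₀` the iterates of `G (qParam t)` converge to `pParam t` geometrically, uniformly on a
disc about `v₀` and uniformly in `t`. -/
lemma exists_uniform_attraction
    (hG : InverseBranch (((σ - 1) ^ 2 * (σ + 1) : ℝ) : ℂ) (σ ^ 2 - 1) G)
    (hσ : 1 < |σ|) {t₀ : ℂ} (ht₀ : Complex.sin t₀ = σ - 1) :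
    ∃ k, 0 ≤ k ∧ k < 1 ∧ ∃ ρ > 0, ∀ᶠ t in 𝓝 t₀,
      ∀ x ∈ Metric.ball ((σ ^ 2 - 1 : ℝ) : ℂ) ρ, ∀ n,
      ‖(G (qParam t))^[n] x - pParam t‖ ≤ k ^ n ∧
      AnalyticAt ℂ (fun z : ℂ × ℂ => (G z.1)^[n] z.2) (qParam t, x) := by
  have hσ2 : 1 < σ ^ 2 := by rw [← sq_abs]; nlinarith
  obtain ⟨k, hk0, hk1, r, hr, hcon⟩ :=
    hG.exists_contraction (by linarith) (hG.norm_deriv_lt_one hσ)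
  set ρ := min (r / 3) (1 / 2) with hρ
  have hρ0 : 0 < ρ := by positivity
  have hρr : ρ ≤ r / 3 := min_le_left _ _
  have hρ1 : ρ ≤ 1 / 2 := min_le_right _ _
  refine ⟨k, hk0, hk1, ρ, hρ0, ?_⟩
  have e1 : ∀ᶠ t in 𝓝 t₀, qParam t ∈ Metric.ball (((σ - 1) ^ 2 * (σ + 1) : ℝ) : ℂ) r := by
    refine (analyticAt_qParam t₀).continuousAt.eventually_mem ?_
    rw [qParam_eq ht₀]; exact Metric.ball_mem_nhds _ hr
  have e2 : ∀ᶠ t in 𝓝 t₀, pParam t ∈ Metric.ball ((σ ^ 2 - 1 : ℝ) : ℂ) ρ := by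
    refine (analyticAt_pParam t₀).continuousAt.eventually_mem ?_
    rw [pParam_eq ht₀]; exact Metric.ball_mem_nhds _ hρ0
  filter_upwards [e1, e2, hG.eventually_fixed hσ ht₀] with t h1 h2 h3 x hx n
  have hpr : pParam t ∈ Metric.ball ((σ ^ 2 - 1 : ℝ) : ℂ) r :=
    Metric.ball_subset_ball (by linarith) h2
  rw [mem_ball_iff_norm] at h2 hx
  have hx0 : ‖x - pParam t‖ ≤ 2 * ρ := by
    have := norm_sub_le_norm_sub_add_norm_sub x ((σ ^ 2 - 1 : ℝ) : ℂ) (pParam t)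
    rw [norm_sub_rev ((σ ^ 2 - 1 : ℝ) : ℂ) (pParam t)] at this
    linarith
  have hmem : ∀ y, ‖y - pParam t‖ ≤ 2 * ρ → y ∈ Metric.ball ((σ ^ 2 - 1 : ℝ) : ℂ) r := by
    intro y hy
    rw [mem_ball_iff_norm]
    have := norm_sub_le_norm_sub_add_norm_sub y (pParam t) ((σ ^ 2 - 1 : ℝ) : ℂ)
    linarith
  have key : ‖(G (qParam t))^[n] x - pParam t‖ ≤ k ^ n * (2 * ρ) ∧
      AnalyticAt ℂ (fun z : ℂ × ℂ => (G z.1)^[n] z.2) (qParam t, x) := by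
    induction n with
    | zero => exact ⟨by simpa using hx0, analyticAt_snd⟩
    | succ n ih =>
      have hb := hmem _ (ih.1.trans (mul_le_of_le_one_left (by positivity)
        (pow_le_one₀ hk0 hk1.le)))
      obtain ⟨ha, hc⟩ := hcon _ h1 _ hb
      constructor
      · rw [Function.iterate_succ_apply', pow_succ', mul_assoc]
        have h4 := hc _ hpr
        rw [h3] at h4
        exact h4.trans (mul_le_mul_of_nonneg_left ih.1 hk0)
      · simp_rw [Function.iterate_succ_apply']
        exact ha.comp₂ analyticAt_fst ih.2
  refine ⟨key.1.trans ?_, key.2⟩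
  exact mul_le_of_le_one_right (by positivity) (by linarith)

/-- If at `t₁` the orbit of `v₀` lands on the fixed point after `K` steps, and `a` is a holomorphic
function with value in the disc of attraction, then for all large `n` there are parameters near
`t₁` at which the orbit passes through `a` after `n + K` steps. The zero at `t₁` of
`N_K - pParam · D_K` is isolated because this entire function does not vanish at `t = 0`, where
`q = 0`. -/
lemma eventually_exists_param {t₁ : ℂ} {v₀ ρ k : ℝ} (hv₀ : 0 < v₀) (hk0 : 0 ≤ k) (hk1 : k < 1)
    {c : ℂ} (hrel : ∀ q v, RenormRel q (G q v) v)
    (hT : ∀ᶠ t in 𝓝 t₁, ∀ x ∈ Metric.ball c ρ, ∀ n,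
      ‖(G (qParam t))^[n] x - pParam t‖ ≤ k ^ n ∧
      AnalyticAt ℂ (fun z : ℂ × ℂ => (G z.1)^[n] z.2) (qParam t, x)) {K : ℕ}
    (hK : ((potStep (qParam t₁))^[K] ((v₀ : ℂ), 1)).1 =
      pParam t₁ * ((potStep (qParam t₁))^[K] ((v₀ : ℂ), 1)).2)
    {a : ℂ → ℂ} (ha : AnalyticAt ℂ a t₁) (hat : a t₁ ∈ Metric.ball c ρ)
    {W : Set ℂ} (hW : W ∈ 𝓝 t₁) :
    ∀ᶠ n in atTop, ∃ t ∈ W, ((potStep (qParam t))^[n + K] ((v₀ : ℂ), 1)).1 =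
      a t * ((potStep (qParam t))^[n + K] ((v₀ : ℂ), 1)).2 := by
  set N : ℂ → ℂ := fun t => ((potStep (qParam t))^[K] ((v₀ : ℂ), 1)).1 with hN
  set D : ℂ → ℂ := fun t => ((potStep (qParam t))^[K] ((v₀ : ℂ), 1)).2 with hD
  have hqd : Differentiable ℂ qParam := fun t => (analyticAt_qParam t).differentiableAt
  have hpd : Differentiable ℂ pParam := fun t => (analyticAt_pParam t).differentiableAt
  have hNd : Differentiable ℂ N := (differentiable_iterate_potStep_fst _ K).comp hqd
  have hDd : Differentiable ℂ D := (differentiable_iterate_potStep_snd _ K).comp hqd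
  have hfd : Differentiable ℂ (fun t => N t - pParam t * D t) := hNd.sub (hpd.mul hDd)
  have hne : ∀ᶠ t in 𝓝[≠] t₁, N t - pParam t * D t ≠ 0 := by
    refine (hfd.analyticAt t₁).eventually_eq_zero_or_eventually_ne_zero.resolve_left fun h => ?_
    have h0 := AnalyticOnNhd.eq_of_eventuallyEq (fun t _ => hfd.analyticAt t)
      (fun t _ => (analyticAt_const : AnalyticAt ℂ (fun _ => (0 : ℂ)) t)) h
    have h1 := congrFun h0 0
    obtain ⟨N', D', hN', hD', h2⟩ := iterate_potStep_zero_pos hv₀ K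
    have hq0 : qParam 0 = 0 := by simp [qParam]
    have hp0 : pParam 0 = 0 := by simp [pParam]
    simp only [hN, hD, hq0, hp0, h2, zero_mul, sub_zero, Complex.ofReal_eq_zero] at h1
    exact hN'.ne' h1
  have hev : ∀ᶠ t in 𝓝 t₁, t ∈ W ∧ AnalyticAt ℂ a t ∧ a t ∈ Metric.ball c ρ ∧
      (∀ x ∈ Metric.ball c ρ, ∀ n, ‖(G (qParam t))^[n] x - pParam t‖ ≤ k ^ n ∧
        AnalyticAt ℂ (fun z : ℂ × ℂ => (G z.1)^[n] z.2) (qParam t, x)) ∧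
      ‖D t‖ < ‖D t₁‖ + 1 := by
    filter_upwards [hW, ha.eventually_analyticAt,
      ha.continuousAt.eventually_mem (Metric.isOpen_ball.mem_nhds hat), hT,
      hDd.continuous.norm.continuousAt.eventually_lt_const (lt_add_one ‖D t₁‖)] with
      t h1 h2 h3 h4 h5 using ⟨h1, h2, h3, h4, h5⟩
  obtain ⟨U, hU, hUt⟩ := hev.exists_mem
  have hlim : TendstoUniformlyOn (fun n t => N t - (G (qParam t))^[n] (a t) * D t)
      (fun t => N t - pParam t * D t) atTop U := by
    rw [Metric.tendstoUniformlyOn_iff]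
    intro ε hε
    have h1 : Tendsto (fun n => k ^ n * (‖D t₁‖ + 1)) atTop (𝓝 0) := by
      simpa using (tendsto_pow_atTop_nhds_zero_of_lt_one hk0 hk1).mul_const (‖D t₁‖ + 1)
    filter_upwards [h1.eventually_lt_const hε] with n hn t ht
    obtain ⟨-, -, h3, h4, h5⟩ := hUt t ht
    rw [dist_eq_norm, show N t - pParam t * D t - (N t - (G (qParam t))^[n] (a t) * D t) =
      ((G (qParam t))^[n] (a t) - pParam t) * D t by ring, norm_mul]
    refine lt_of_le_of_lt ?_ hn
    exact mul_le_mul (h4 _ h3 n).1 h5.le (norm_nonneg _) (by positivity)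
  have hFd : ∀ n, DifferentiableOn ℂ (fun t => N t - (G (qParam t))^[n] (a t) * D t) U := by
    intro n t ht
    obtain ⟨-, h2, h3, h4, -⟩ := hUt t ht
    exact (hNd t).sub ((((h4 _ h3 n).2.comp₂ (analyticAt_qParam t) h2).differentiableAt).mul
      (hDd t)) |>.differentiableWithinAt
  filter_upwards [eventually_exists_zero hU hFd hlim (sub_eq_zero.2 hK) hne] with n hn
  obtain ⟨t, ht, h0⟩ := hn
  refine ⟨t, (hUt t ht).1, ?_⟩
  rw [Function.iterate_add_apply]
  exact iterate_potStep_of_rel (hrel _) n (sub_eq_zero.1 h0)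

end InverseBranch

/-! ### Backward orbits of the fixed point and of `-q` -/

/-- An orbit that passes through `a` passes through `b` after `j` further steps. -/
def OrbitRel (q : ℂ) (j : ℕ) (a b : ℂ) : Prop :=
  ∀ x : ℂ × ℂ, x.1 = a * x.2 → ((potStep q)^[j] x).1 = b * ((potStep q)^[j] x).2

lemma RenormRel.orbitRel {q a b : ℂ} (h : RenormRel q a b) : OrbitRel q 1 a b :=
  fun _ hx => h.potStep hx

lemma OrbitRel.trans {q a b c : ℂ} {i j : ℕ} (h : OrbitRel q i a b) (h' : OrbitRel q j b c) :
    OrbitRel q (j + i) a c := fun x hx => by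
  rw [Function.iterate_add_apply]
  exact h' _ (h x hx)

lemma orbitRel_iterate {q : ℂ} {g : ℂ → ℂ} (hg : ∀ v, RenormRel q (g v) v) (a : ℂ) (n : ℕ) :
    OrbitRel q n (g^[n] a) a := fun _ hx => iterate_potStep_of_rel hg n hx

lemma mem_slitPlane_of_im_ne_zero {z : ℂ} (h : z.im ≠ 0) : z ∈ Complex.slitPlane := Or.inr h

/-- A point with nonreal series reduction is nonreal. -/
lemma im_ne_zero_of_series {q : ℝ} (hq : q ≠ 0) {a u : ℂ} (h : a ^ 2 = u * (q + 2 * a))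
    (hu : u.im ≠ 0) : a.im ≠ 0 := by
  intro ha
  obtain ⟨x, rfl⟩ : ∃ x : ℝ, a = x := ⟨a.re, Complex.ext rfl (by simpa using ha)⟩
  have h1 : (u * ((q + 2 * x : ℝ) : ℂ)).im = 0 := by
    push_cast
    rw [← h]
    norm_cast
  rw [Complex.im_mul_ofReal] at h1
  have h2 : q + 2 * x = 0 := (mul_eq_zero.1 h1).resolve_left hu
  rw [show (q : ℂ) + 2 * x = ((q + 2 * x : ℝ) : ℂ) by push_cast; rfl, h2] at h
  have h3 : x = 0 := by simpa using h
  rw [h3] at h2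
  exact hq (by linarith)

lemma renormRel_neg_sin_sq (t : ℂ) : RenormRel (qParam t) (-Complex.sin t ^ 2) (pParam t) := by
  refine RenormRel.of_series (u := Complex.sin t) ?_ ?_
  · unfold qParam; ring
  · unfold pParam; ring

/-- A holomorphic family of second preimages of the fixed point, nonreal at the critical parameter.
Its image is `-sin² t = cos² t - 1`, so its series reduction is `u = cos t - 1`. -/
lemma exists_homoclinic {σ : ℝ} (hσ : 1 < |σ|) :
    ∃ t₀ : ℂ, Complex.sin t₀ = σ - 1 ∧ ∃ b : ℂ → ℂ, AnalyticAt ℂ b t₀ ∧ (b t₀).im ≠ 0 ∧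
      ∀ t, RenormRel (qParam t) (b t) (-Complex.sin t ^ 2) := by
  set R : ℂ → ℂ := fun t => (1 + Complex.cos t) * (2 + Complex.sin t) - 1 with hR
  set b : ℂ → ℂ := fun t => (Complex.cos t - 1) * (1 + Complex.I * Complex.sqrt (R t)) with hb
  have hcos : ∀ t, AnalyticAt ℂ Complex.cos t := fun t => Complex.differentiable_cos.analyticAt t
  have hRa : ∀ t, AnalyticAt ℂ R t := fun t =>
    ((analyticAt_const.fun_add (hcos t)).fun_mul
      (analyticAt_const.fun_add (analyticAt_complexSin t))).fun_sub analyticAt_const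
  have hba : ∀ t, R t ∈ Complex.slitPlane → AnalyticAt ℂ b t := fun t ht =>
    ((hcos t).fun_sub analyticAt_const).fun_mul (analyticAt_const.fun_add
      (analyticAt_const.fun_mul (analyticAt_sqrt_comp (hRa t) ht)))
  have hseries : ∀ t, b t ^ 2 = (Complex.cos t - 1) * (qParam t + 2 * b t) := by
    intro t
    have h1 := complexSqrt_sq (R t)
    have h2 := Complex.sin_sq_add_cos_sq t
    have h3 : R t = (1 + Complex.cos t) * (2 + Complex.sin t) - 1 := rfl
    simp only [hb]
    unfold qParam
    linear_combination (Complex.cos t - 1) ^ 2 * Complex.sqrt (R t) ^ 2 * Complex.I_sq -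
      (Complex.cos t - 1) ^ 2 * (h1 + h3) -
      (Complex.cos t - 1) * (2 + Complex.sin t) * h2
  have hrel : ∀ t, RenormRel (qParam t) (b t) (-Complex.sin t ^ 2) := fun t =>
    RenormRel.of_series (hseries t) (by
      linear_combination (-1) * Complex.sin_sq_add_cos_sq t)
  -- For `1 < σ ≤ 2` there is a real `t₀` with `0 ≤ cos t₀ < 1`. Otherwise `cos² t₀ = σ(2 - σ) < 0`.
  by_cases hcase : 1 < σ ∧ σ ≤ 2
  · obtain ⟨h1, h2⟩ := hcase
    set c := Real.cos (Real.arcsin (σ - 1)) with hc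
    have hs : Real.sin (Real.arcsin (σ - 1)) = σ - 1 :=
      Real.sin_arcsin (by linarith) (by linarith)
    have hc0 : 0 ≤ c := Real.cos_arcsin_nonneg _
    have hc1 : c < 1 := by
      have := Real.sin_sq_add_cos_sq (Real.arcsin (σ - 1))
      rw [hs, ← hc] at this
      nlinarith [mul_pos (sub_pos.2 h1) (sub_pos.2 h1)]
    have hRv : R (Real.arcsin (σ - 1)) = (((1 + c) * (1 + σ) - 1 : ℝ) : ℂ) := by
      simp only [hR]
      rw [← Complex.ofReal_cos, ← Complex.ofReal_sin, hs, ← hc]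
      push_cast; ring
    have hRp : 0 < (1 + c) * (1 + σ) - 1 := by nlinarith
    refine ⟨Real.arcsin (σ - 1), ?_, b, hba _ ?_, ?_, hrel⟩
    · rw [← Complex.ofReal_sin, hs]; push_cast; rfl
    · rw [hRv]; exact ofReal_mem_slitPlane_of_pos hRp
    · have : b (Real.arcsin (σ - 1)) = ((c - 1 : ℝ) : ℂ) *
          (1 + Complex.I * (√((1 + c) * (1 + σ) - 1) : ℝ)) := by
        simp only [hb]
        rw [hRv, Complex.sqrt_of_nonneg (by exact_mod_cast hRp.le), Complex.ofReal_re,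
          ← Complex.ofReal_cos, ← hc]
        push_cast; rfl
      rw [this, Complex.im_ofReal_mul]
      have h3 : c - 1 ≠ 0 := by linarith
      have h4 := Real.sqrt_pos.2 hRp
      simpa using ⟨h3, h4.ne'⟩
  · obtain ⟨t, ht⟩ := Complex.sin_surjective ((σ : ℂ) - 1)
    have hneg : σ * (2 - σ) < 0 := by
      rcases lt_abs.1 hσ with h | h
      · have : 2 < σ := by
          by_contra! h'
          exact hcase ⟨h, h'⟩
        nlinarith
      · nlinarith
    have hc2 : Complex.cos t ^ 2 = ((σ * (2 - σ) : ℝ) : ℂ) := by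
      have := Complex.sin_sq_add_cos_sq t
      rw [ht] at this
      push_cast
      linear_combination this
    have hcim : (Complex.cos t).im ≠ 0 := by
      intro h
      have h1 := congrArg Complex.re hc2
      rw [sq, Complex.mul_re, h, Complex.ofReal_re] at h1
      nlinarith [mul_self_nonneg (Complex.cos t).re]
    have hσ1 : 1 + σ ≠ 0 := by
      intro h
      rw [show σ = -1 by linarith] at hσ
      norm_num at hσ
    have hRim : (R t).im ≠ 0 := by
      have : R t = (1 + Complex.cos t) * ((1 + σ : ℝ) : ℂ) - 1 := by
        simp only [hR]; rw [ht]; push_cast; ring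
      rw [this, Complex.sub_im, Complex.im_mul_ofReal]
      simpa using ⟨hcim, hσ1⟩
    refine ⟨t, ht, b, hba _ (mem_slitPlane_of_im_ne_zero hRim), ?_, hrel⟩
    have h1 := hseries t
    rw [qParam_eq ht] at h1
    refine im_ne_zero_of_series ?_ h1 (by simpa using hcim)
    refine mul_ne_zero (pow_ne_zero 2 ?_) (by rwa [add_comm])
    intro h
    rw [show σ = 1 by linarith] at hσ
    norm_num at hσ

/-- The preimages of `-q` under `F_q` are `-(1 + e)(1 + e²)` for `e⁴ = 1 - q`; a nonreal `e` gives a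
nonreal preimage. -/
lemma exists_target_of_ne_one {q : ℝ} (hq0 : q ≠ 0) (hq1 : q ≠ 1) {t₀ : ℂ} (ht₀ : qParam t₀ = q) :
    ∃ a : ℂ → ℂ, AnalyticAt ℂ a t₀ ∧ (a t₀).im ≠ 0 ∧
      ∀ t, RenormRel (qParam t) (a t) (-qParam t) := by
  have h1q : (1 : ℂ) - q ≠ 0 := by
    rw [sub_ne_zero]; exact_mod_cast hq1.symm
  obtain ⟨e₀, he₀, him⟩ : ∃ e : ℂ, e ^ 4 = 1 - q ∧ e.im ≠ 0 := by
    obtain ⟨e, he⟩ := IsAlgClosed.exists_pow_nat_eq ((1 : ℂ) - q) (by norm_num : 0 < 4)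
    by_cases h : e.im = 0
    · refine ⟨Complex.I * e, by rw [mul_pow, Complex.I_pow_four, one_mul, he], ?_⟩
      have : e.re ≠ 0 := fun h' => h1q (by
        rw [← he, show e = 0 from Complex.ext h' h]; simp)
      simpa using this
    · exact ⟨e, he, h⟩
  have he0 : e₀ ≠ 0 := fun h => him (by rw [h]; rfl)
  obtain ⟨s, hs, hs0, hs2⟩ := exists_analyticAt_sq_eq (h := fun t => 1 - qParam t) (z₀ := t₀)
    (c := e₀ ^ 2) (analyticAt_const.fun_sub (analyticAt_qParam t₀))
    (by rw [ht₀, ← he₀]; ring) (pow_ne_zero 2 he0)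
  obtain ⟨e, hea, he1, he2⟩ := exists_analyticAt_sq_eq (h := s) (z₀ := t₀) hs hs0.symm he0
  have hq : ∀ t, qParam t = 1 - e t ^ 4 := fun t => by
    have h1 := he2 t
    have h2 := hs2 t
    rw [← h1] at h2
    linear_combination h2
  refine ⟨fun t => -((1 + e t) * (1 + e t ^ 2)),
    ((analyticAt_const.fun_add hea).fun_mul (analyticAt_const.fun_add (hea.fun_pow 2))).fun_neg, ?_,
    fun t => RenormRel.of_series (u := -1 - e t ^ 2) ?_ ?_⟩
  · intro h
    have h1 : -((1 + e t₀) * (1 + e t₀ ^ 2)) * (e t₀ - 1) = q := by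
      rw [← ht₀, hq]; ring
    obtain ⟨x, hx⟩ : ∃ x : ℝ, -((1 + e t₀) * (1 + e t₀ ^ 2)) = x :=
      ⟨_, Complex.ext rfl (by simpa using h)⟩
    rw [hx] at h1
    have h2 := congrArg Complex.im h1
    rw [Complex.im_ofReal_mul, Complex.ofReal_im, he1, Complex.sub_im, Complex.one_im,
      sub_zero] at h2
    have hx0 : x = 0 := (mul_eq_zero.1 h2).resolve_right him
    rw [hx0] at h1
    simp at h1
    exact hq0 (by exact_mod_cast h1.symm)
  · rw [hq]; ring
  · rw [hq]; ring

/-- In the coordinate `y = 1 + v` the relation `F_q(v) = w` reads `y = s + D` with `s² = 1 + w` and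
`D² = (s - 1)(s - η)`, `η = 1 - q`. For `|η| ≤ |s|²` and small `s` one has `D² ≈ -s`, so `y` is of
size about `|1 + w|^{1/4}`. With `Re s ≥ 0` and `Im D ≥ 0`, the argument of `y` is bounded away from
`0` and `π`. -/
lemma exists_lift_near_neg_one {t₁ : ℂ} {w : ℂ → ℂ} (hw : AnalyticAt ℂ w t₁)
    (h0 : 1 + w t₁ ≠ 0) (hsmall : ‖1 + w t₁‖ ≤ 1 / 4096) (hη : ‖1 - qParam t₁‖ ≤ ‖1 + w t₁‖) :
    ∃ a : ℂ → ℂ, AnalyticAt ℂ a t₁ ∧ (∀ t, RenormRel (qParam t) (a t) (w t)) ∧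
      2 * ‖1 + w t₁‖ ≤ ‖1 + a t₁‖ ∧ ‖1 + a t₁‖ ≤ 1 ∧ 2 / 5 * ‖1 + a t₁‖ ≤ (1 + a t₁).im := by
  set s₀ := Complex.sqrt (1 + w t₁) with hs₀
  have hs₀2 : s₀ ^ 2 = 1 + w t₁ := complexSqrt_sq _
  have hs₀re : 0 ≤ s₀.re := re_sqrt_nonneg _
  have hs₀0 : s₀ ≠ 0 := fun h => h0 (by rw [← hs₀2, h]; simp)
  set η := 1 - qParam t₁ with hηd
  set S := ‖s₀‖ with hS
  have hS0 : 0 < S := norm_pos_iff.2 hs₀0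
  have hS2 : ‖1 + w t₁‖ = S ^ 2 := by rw [← hs₀2, norm_pow]
  rw [hS2] at hsmall hη
  have hS1 : S ≤ 1 / 64 := by nlinarith
  set E := (s₀ - 1) * (s₀ - η) with hE
  have hEs : ‖E + s₀‖ ≤ 3 * S ^ 2 := by
    have h1 : E + s₀ = s₀ ^ 2 + η - s₀ * η := by rw [hE]; ring
    rw [h1]
    have h2 := norm_sub_le (s₀ ^ 2 + η) (s₀ * η)
    have h3 := norm_add_le (s₀ ^ 2) η
    rw [norm_mul] at h2
    rw [norm_pow] at h3
    have h4 : ‖s₀‖ * ‖η‖ ≤ 1 * S ^ 2 := mul_le_mul (by linarith) hη (norm_nonneg _) zero_le_one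
    linarith
  have hE1 : 61 / 64 * S ≤ ‖E‖ := by
    have := norm_sub_norm_le (-s₀) (-s₀ - E)
    rw [sub_sub_cancel, norm_neg, show -s₀ - E = -(E + s₀) by ring, norm_neg] at this
    nlinarith
  have hE2 : ‖E‖ ≤ 67 / 64 * S := by
    have := norm_sub_le (E + s₀) s₀
    rw [add_sub_cancel_right] at this
    nlinarith
  have hE3 : E.re ≤ 3 / 64 * S := by
    have h1 := Complex.re_le_norm (E + s₀)
    rw [Complex.add_re] at h1
    nlinarith
  obtain ⟨D₀, hD2, hDim⟩ : ∃ D : ℂ, D ^ 2 = E ∧ 0 ≤ D.im := by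
    rcases le_total 0 (Complex.sqrt E).im with h | h
    · exact ⟨_, complexSqrt_sq E, h⟩
    · exact ⟨-Complex.sqrt E, by rw [neg_sq, complexSqrt_sq], by simpa using h⟩
  have hE0 : 0 < ‖E‖ := lt_of_lt_of_le (by positivity) hE1
  have hD0 : D₀ ≠ 0 := fun h => norm_pos_iff.1 hE0 (by rw [← hD2, h]; simp)
  have hDn : ‖D₀‖ ^ 2 = ‖E‖ := by rw [← hD2, norm_pow]
  have hDim2 : 29 / 64 * S ≤ D₀.im ^ 2 := by
    have h1 : ‖D₀‖ ^ 2 = D₀.re ^ 2 + D₀.im ^ 2 := by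
      rw [Complex.sq_norm, Complex.normSq_apply]; ring
    have h2 : E.re = D₀.re ^ 2 - D₀.im ^ 2 := by
      rw [← hD2, sq, Complex.mul_re]; ring
    linarith
  obtain ⟨T, hT0, hT⟩ : ∃ T : ℝ, 0 < T ∧ T ^ 2 = S := ⟨√S, Real.sqrt_pos.2 hS0, Real.sq_sqrt hS0.le⟩
  have hT1 : T ≤ 1 / 8 := by
    rw [← hT] at hS1; nlinarith
  have hST : S ≤ 1 / 8 * T := by rw [← hT]; nlinarith
  have hDT1 : 5 / 8 * T ≤ D₀.im := by
    refine le_of_sq_le_sq ?_ hDim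
    rw [← hT] at hDim2
    nlinarith [sq_nonneg T]
  have hDT2 : ‖D₀‖ ≤ 9 / 8 * T := by
    refine le_of_sq_le_sq ?_ (by positivity)
    rw [hDn]
    rw [← hT] at hE2
    nlinarith [sq_nonneg T]
  have hyim : 1 / 2 * T ≤ (s₀ + D₀).im := by
    have := (abs_le.1 (Complex.abs_im_le_norm s₀)).1
    rw [Complex.add_im]
    linarith
  have hynorm : ‖s₀ + D₀‖ ≤ 5 / 4 * T := by
    have := norm_add_le s₀ D₀
    linarith
  obtain ⟨s, hsa, hst, hs2⟩ := exists_analyticAt_sq_eq (h := fun t => 1 + w t)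
    (analyticAt_const.fun_add hw) hs₀2 hs₀0
  obtain ⟨D, hDa, hDt, hDD⟩ := exists_analyticAt_sq_eq
    (h := fun t => (s t - 1) * (s t - (1 - qParam t))) (z₀ := t₁) (c := D₀)
    ((hsa.fun_sub analyticAt_const).fun_mul
      (hsa.fun_sub (analyticAt_const.fun_sub (analyticAt_qParam t₁))))
    (by rw [hD2, hst]) hD0
  have hval : 1 + (s t₁ + D t₁ - 1) = s₀ + D₀ := by rw [hst, hDt]; ring
  refine ⟨fun t => s t + D t - 1, (hsa.fun_add hDa).fun_sub analyticAt_const, fun t => ?_,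
    ?_, ?_, ?_⟩
  · refine RenormRel.of_series (u := s t - 1) ?_ ?_
    · linear_combination hDD t
    · linear_combination -hs2 t
  · simp only [hval]
    rw [hS2]
    have h1 := Complex.im_le_norm (s₀ + D₀)
    have h2 : 2 * S ^ 2 ≤ 1 / 2 * T := by
      have : S ^ 2 ≤ 1 / 64 * S := by nlinarith
      linarith
    linarith
  · simp only [hval]
    linarith
  · simp only [hval]
    linarith

/-- Iterating the backward step, which at least doubles `|1 + w|`, until this exceeds `1 / 4096`. -/
lemma exists_chain_near_neg_one {t₁ : ℂ} (n : ℕ) {w : ℂ → ℂ} (hw : AnalyticAt ℂ w t₁)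
    (h0 : 1 + w t₁ ≠ 0) (hsmall : ‖1 + w t₁‖ ≤ 1 / 4096) (hη : ‖1 - qParam t₁‖ ≤ ‖1 + w t₁‖)
    (hn : 1 / 4096 < 2 ^ n * ‖1 + w t₁‖) :
    ∃ a : ℂ → ℂ, AnalyticAt ℂ a t₁ ∧ (∃ j, ∀ t, OrbitRel (qParam t) j (a t) (w t)) ∧
      ‖1 + a t₁‖ ≤ 1 ∧ 1 / 10240 ≤ (1 + a t₁).im := by
  induction n generalizing w with
  | zero => rw [pow_zero, one_mul] at hn; linarith
  | succ n ih =>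
    obtain ⟨a, haa, hrel, h1, h2, h3⟩ := exists_lift_near_neg_one hw h0 hsmall hη
    by_cases hbig : 1 / 4096 < ‖1 + a t₁‖
    · exact ⟨a, haa, ⟨1, fun t => (hrel t).orbitRel⟩, h2, by linarith⟩
    · have hpos := norm_pos_iff.2 h0
      obtain ⟨a', ha', ⟨j, hj⟩, h5, h6⟩ := ih haa (norm_pos_iff.1 (by linarith)) (not_lt.1 hbig)
        (by linarith) (by
          rw [pow_succ, mul_assoc] at hn
          exact hn.trans_le (mul_le_mul_of_nonneg_left h1 (by positivity)))
      exact ⟨a', ha', ⟨_, fun t => (hj t).trans (hrel t).orbitRel⟩, h5, h6⟩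

/-- The backward orbit starts at `w = -q`, where `1 + w = 1 - q`. -/
lemma exists_target_near_one {t₁ : ℂ} (h0 : qParam t₁ ≠ 1) (hsmall : ‖1 - qParam t₁‖ ≤ 1 / 4096) :
    ∃ a : ℂ → ℂ, AnalyticAt ℂ a t₁ ∧ (∃ j, ∀ t, OrbitRel (qParam t) j (a t) (-qParam t)) ∧
      ‖1 + a t₁‖ ≤ 1 ∧ 1 / 10240 ≤ (1 + a t₁).im := by
  have h1 : (1 : ℂ) + -qParam t₁ = 1 - qParam t₁ := by ring
  have h2 : 1 - qParam t₁ ≠ 0 := sub_ne_zero.2 h0.symm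
  have h3 := norm_pos_iff.2 h2
  obtain ⟨n, hn⟩ := pow_unbounded_of_one_lt (1 / 4096 / ‖1 - qParam t₁‖) (one_lt_two (α := ℝ))
  refine exists_chain_near_neg_one n (analyticAt_qParam t₁).fun_neg ?_ ?_ ?_ ?_
  · rwa [h1]
  · rwa [h1]
  · rw [h1]
  · rw [h1]
    exact (div_lt_iff₀ h3).1 hn

/-! ### Accumulation of zeros at the critical parameters -/

/-- Orbits through `-q` are zeros of the partition function. -/
lemma pottsZ_eq_zero_of_orbitRel {q v a : ℂ} {j m : ℕ} (h : OrbitRel q j a (-q))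
    (hm : ((potStep q)^[m] (v, 1)).1 = a * ((potStep q)^[m] (v, 1)).2) :
    pottsZ (diamondGraph (j + m)) q v = 0 := by
  rw [pottsZ_diamondGraph, Function.iterate_add_apply, h _ hm]
  ring

namespace InverseBranch

variable {σ : ℝ} {G : ℂ → ℂ → ℂ}

/-- Every point of the slit plane is carried into the disc of attraction by some iterate of `G`,
also after a small change of the point and the parameter. -/
lemma eventually_exists_iterate_mem
    (hG : InverseBranch (((σ - 1) ^ 2 * (σ + 1) : ℝ) : ℂ) (σ ^ 2 - 1) G) (hσ : 1 < |σ|)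
    {ρ : ℝ} (hρ : 0 < ρ) {x : ℂ} (hx : x ∈ Complex.slitPlane) :
    ∀ᶠ z : ℂ × ℂ in 𝓝 ((((σ - 1) ^ 2 * (σ + 1) : ℝ) : ℂ), x), ∃ i,
      (G z.1)^[i] z.2 ∈ Metric.ball ((σ ^ 2 - 1 : ℝ) : ℂ) ρ ∧
      AnalyticAt ℂ (fun z : ℂ × ℂ => (G z.1)^[i] z.2) z := by
  obtain ⟨i, hi⟩ := ((hG.tendsto_iterate hσ hx).eventually_mem (Metric.ball_mem_nhds _ hρ)).exists
  have ha := hG.analyticAt_iterate hx i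
  filter_upwards [ha.eventually_analyticAt,
    ha.continuousAt.eventually_mem (Metric.isOpen_ball.mem_nhds hi)] with z h1 h2
  exact ⟨i, h2, h1⟩

/-- At the critical parameter the orbit of `v₀` is constant. -/
lemma iterate_potStep_fixed (hσ : 1 < |σ|) (m : ℕ) :
    ((potStep (((σ - 1) ^ 2 * (σ + 1) : ℝ) : ℂ))^[m] (((σ ^ 2 - 1 : ℝ) : ℂ), 1)).1 =
      ((σ ^ 2 - 1 : ℝ) : ℂ) *
        ((potStep (((σ - 1) ^ 2 * (σ + 1) : ℝ) : ℂ))^[m] (((σ ^ 2 - 1 : ℝ) : ℂ), 1)).2 ∧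
    ((potStep (((σ - 1) ^ 2 * (σ + 1) : ℝ) : ℂ))^[m] (((σ ^ 2 - 1 : ℝ) : ℂ), 1)).2 ≠ 0 := by
  have hσ2 : 1 < σ ^ 2 := by rw [← sq_abs]; nlinarith
  induction m with
  | zero => simp
  | succ m ih =>
    rw [Function.iterate_succ_apply']
    obtain ⟨h1, h2⟩ := ih
    refine ⟨RenormRel.potStep ?_ h1, ?_⟩
    · refine RenormRel.of_series (u := ((σ - 1 : ℝ) : ℂ)) ?_ ?_ <;> push_cast <;> ring
    · simp only [potStep]
      rw [h1]
      refine pow_ne_zero 2 (mul_ne_zero h2 ?_)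
      rw [show (((σ - 1) ^ 2 * (σ + 1) : ℝ) : ℂ) *
        ((potStep (((σ - 1) ^ 2 * (σ + 1) : ℝ) : ℂ))^[m] (((σ ^ 2 - 1 : ℝ) : ℂ), 1)).2 +
        2 * (((σ ^ 2 - 1 : ℝ) : ℂ) *
        ((potStep (((σ - 1) ^ 2 * (σ + 1) : ℝ) : ℂ))^[m] (((σ ^ 2 - 1 : ℝ) : ℂ), 1)).2) =
        (((σ ^ 2 - 1) * (σ + 1) : ℝ) : ℂ) *
        ((potStep (((σ - 1) ^ 2 * (σ + 1) : ℝ) : ℂ))^[m] (((σ ^ 2 - 1 : ℝ) : ℂ), 1)).2 by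
          push_cast; ring]
      refine mul_ne_zero (Complex.ofReal_ne_zero.2 (mul_ne_zero (by linarith) ?_)) h2
      intro h
      rw [show σ = -1 by linarith] at hσ2
      norm_num at hσ2

/-- Near the critical parameter there are parameters other than it at which the orbit of `v₀` lands
on the repelling fixed point, and the zeros accumulate at each of them. -/
lemma mem_derivedSet (hG : InverseBranch (((σ - 1) ^ 2 * (σ + 1) : ℝ) : ℂ) (σ ^ 2 - 1) G)
    (hσ : 1 < |σ|) :
    (((σ - 1) ^ 2 * (σ + 1) : ℝ) : ℂ) ∈ derivedSet (zeroLimitSet ((σ ^ 2 - 1 : ℝ) : ℂ)) := by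
  have hσ2 : 1 < σ ^ 2 := by rw [← sq_abs]; nlinarith
  have hv₀ : 0 < σ ^ 2 - 1 := by linarith
  obtain ⟨t₀, ht₀, b, hb, hbim, hbrel⟩ := exists_homoclinic hσ
  obtain ⟨k, hk0, hk1, ρ, hρ, hT⟩ := hG.exists_uniform_attraction hσ ht₀
  set q₀ : ℝ := (σ - 1) ^ 2 * (σ + 1) with hq₀
  set v₀ : ℝ := σ ^ 2 - 1 with hv
  have hqt : qParam t₀ = q₀ := qParam_eq ht₀
  have hpt : pParam t₀ = v₀ := pParam_eq ht₀
  have hqc : ContinuousAt qParam t₀ := (analyticAt_qParam t₀).continuousAt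
  have hq0 : q₀ ≠ 0 := by
    refine mul_ne_zero (pow_ne_zero 2 fun h => ?_) fun h => ?_
    · rw [show σ = 1 by linarith] at hσ2; norm_num at hσ2
    · rw [show σ = -1 by linarith] at hσ2; norm_num at hσ2
  -- Backward orbits of `-q` that end in the contraction disc.
  have hgood : ∀ᶠ t₁ in 𝓝 t₀, qParam t₁ ≠ q₀ → ∃ a : ℂ → ℂ, AnalyticAt ℂ a t₁ ∧
      a t₁ ∈ Metric.ball (v₀ : ℂ) ρ ∧ ∃ j, ∀ t, OrbitRel (qParam t) j (a t) (-qParam t) := by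
    have hlift : ∀ (t₁ : ℂ) (a : ℂ → ℂ), AnalyticAt ℂ a t₁ →
        (∃ j, ∀ t, OrbitRel (qParam t) j (a t) (-qParam t)) →
        (∃ i, (G (qParam t₁))^[i] (a t₁) ∈ Metric.ball (v₀ : ℂ) ρ ∧
          AnalyticAt ℂ (fun z : ℂ × ℂ => (G z.1)^[i] z.2) (qParam t₁, a t₁)) →
        ∃ a : ℂ → ℂ, AnalyticAt ℂ a t₁ ∧
          a t₁ ∈ Metric.ball (v₀ : ℂ) ρ ∧ ∃ j, ∀ t, OrbitRel (qParam t) j (a t) (-qParam t) := by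
      rintro t₁ a ha ⟨j, hj⟩ ⟨i, hi, hia⟩
      exact ⟨fun t => (G (qParam t))^[i] (a t), hia.comp₂ (analyticAt_qParam t₁) ha, hi, _,
        fun t => (orbitRel_iterate (hG.rel _) _ i).trans (hj t)⟩
    -- For `q₀ = 1` the backward orbits end in a fixed compact subset of the upper half-plane.
    by_cases h1 : q₀ = 1
    · have hK : IsCompact {y : ℂ | ‖1 + y‖ ≤ 1 ∧ 1 / 10240 ≤ (1 + y).im} := by
        refine (isCompact_closedBall (-1 : ℂ) 1).of_isClosed_subset ?_ ?_
        · have e1 : Continuous fun y : ℂ => ‖1 + y‖ := by fun_prop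
          have e2 : Continuous fun y : ℂ => (1 + y).im := by fun_prop
          exact (isClosed_le e1 continuous_const).inter (isClosed_le continuous_const e2)
        · rintro y ⟨hy, -⟩
          rw [mem_closedBall_iff_norm]
          rwa [sub_neg_eq_add, add_comm]
      have htube : ∀ᶠ q in 𝓝 (q₀ : ℂ), ∀ y ∈ {y : ℂ | ‖1 + y‖ ≤ 1 ∧ 1 / 10240 ≤ (1 + y).im},
          ∃ i, (G q)^[i] y ∈ Metric.ball (v₀ : ℂ) ρ ∧
            AnalyticAt ℂ (fun z : ℂ × ℂ => (G z.1)^[i] z.2) (q, y) := by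
        refine hK.eventually_forall_of_forall_eventually fun y hy => ?_
        have hy' : y ∈ Complex.slitPlane := by
          refine mem_slitPlane_of_im_ne_zero ?_
          have := hy.2
          rw [Complex.add_im, Complex.one_im, zero_add] at this
          linarith
        exact hG.eventually_exists_iterate_mem hσ hρ hy'
      have hsmall : ∀ᶠ t in 𝓝 t₀, ‖1 - qParam t‖ < 1 / 4096 := by
        refine Tendsto.eventually_lt_const ?_ (continuousAt_const.sub hqc).norm
        change ‖1 - qParam t₀‖ < 1 / 4096
        rw [hqt, h1]
        norm_num
      rw [← hqt] at htube
      filter_upwards [hqc.eventually htube, hsmall] with t₁ h2 h3 h4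
      rw [h1] at h4
      obtain ⟨a, ha, hj, ha1, ha2⟩ := exists_target_near_one (by simpa using h4) h3.le
      exact hlift t₁ a ha hj (h2 _ ⟨ha1, ha2⟩)
    · obtain ⟨a, ha, him, hrel⟩ := exists_target_of_ne_one hq0 h1 hqt
      have h2 := hG.eventually_exists_iterate_mem hσ hρ (mem_slitPlane_of_im_ne_zero him)
      have h3 : ContinuousAt (fun t => (qParam t, a t)) t₀ := hqc.prodMk ha.continuousAt
      rw [← hq₀, ← hqt] at h2
      filter_upwards [h3.eventually h2, ha.eventually_analyticAt] with t₁ h4 h5 _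
      exact hlift t₁ a h5 ⟨1, fun t => (hrel t).orbitRel⟩ h4
  rw [_root_.mem_derivedSet, accPt_iff_nhds]
  intro U hU
  rw [← hqt] at hU
  -- A parameter near `t₀` at which the orbit of `v₀` lands on the fixed point.
  obtain ⟨t₁, ⟨htU, hbne, hTt, hgt⟩, K, hK⟩ : ∃ t₁, (qParam t₁ ∈ U ∧ b t₁ ≠ v₀ ∧
      (∀ᶠ t in 𝓝 t₁, ∀ x ∈ Metric.ball (v₀ : ℂ) ρ, ∀ n,
        ‖(G (qParam t))^[n] x - pParam t‖ ≤ k ^ n ∧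
        AnalyticAt ℂ (fun z : ℂ × ℂ => (G z.1)^[n] z.2) (qParam t, x)) ∧
      (qParam t₁ ≠ q₀ → ∃ a : ℂ → ℂ, AnalyticAt ℂ a t₁ ∧
        a t₁ ∈ Metric.ball (v₀ : ℂ) ρ ∧ ∃ j, ∀ t, OrbitRel (qParam t) j (a t) (-qParam t))) ∧
      ∃ m, ((potStep (qParam t₁))^[m] ((v₀ : ℂ), 1)).1 =
        b t₁ * ((potStep (qParam t₁))^[m] ((v₀ : ℂ), 1)).2 := by
    have hbv : b t₀ ≠ v₀ := fun h => hbim (by rw [h, Complex.ofReal_im])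
    have hW := (hqc.eventually_mem hU).and ((hb.continuousAt.eventually_ne hbv).and
      (hT.eventually_nhds.and hgood))
    have h2 := hG.eventually_exists_iterate_mem hσ hρ (mem_slitPlane_of_im_ne_zero hbim)
    obtain ⟨i, hi, hia⟩ := h2.self_of_nhds
    rw [← hq₀, ← hqt] at hi hia
    have hmain := eventually_exists_param hv₀ hk0 hk1 hG.rel hT (K := 0)
      (by simp [hpt]) (hia.comp₂ (analyticAt_qParam t₀) hb) hi hW
    obtain ⟨n, t₁, ht₁, h3⟩ := hmain.exists
    refine ⟨t₁, ht₁, i + (n + 0), ?_⟩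
    rw [Function.iterate_add_apply]
    exact orbitRel_iterate (hG.rel _) _ i _ h3
  have hqne : qParam t₁ ≠ q₀ := by
    intro h
    rw [h] at hK
    obtain ⟨h1, h2⟩ := iterate_potStep_fixed hσ K
    rw [← hq₀, ← hv] at h1 h2
    rw [h1] at hK
    exact hbne (mul_right_cancel₀ h2 hK).symm
  obtain ⟨a, ha, hat, j, hj⟩ := hgt hqne
  have hKp : ((potStep (qParam t₁))^[1 + 1 + K] ((v₀ : ℂ), 1)).1 =
      pParam t₁ * ((potStep (qParam t₁))^[1 + 1 + K] ((v₀ : ℂ), 1)).2 := by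
    rw [Function.iterate_add_apply]
    exact (hbrel t₁).orbitRel.trans (renormRel_neg_sin_sq t₁).orbitRel _ hK
  refine ⟨qParam t₁, ⟨htU, fun V hV => ?_⟩, hqne⟩
  have hmain := eventually_exists_param hv₀ hk0 hk1 hG.rel hTt hKp ha hat
    ((analyticAt_qParam t₁).continuousAt.preimage_mem_nhds hV)
  rw [frequently_atTop]
  intro M
  obtain ⟨n, ⟨t, htV, ht⟩, hn⟩ := (hmain.and (eventually_ge_atTop M)).exists
  exact ⟨j + (n + (1 + 1 + K)), by omega, qParam t, htV, pottsZ_eq_zero_of_orbitRel (hj t) ht⟩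

end InverseBranch

lemma mem_derivedSet_of_one_lt_abs {σ : ℝ} (hσ : 1 < |σ|) :
    (((σ - 1) ^ 2 * (σ + 1) : ℝ) : ℂ) ∈ derivedSet (zeroLimitSet ((σ ^ 2 - 1 : ℝ) : ℂ)) := by
  rcases lt_abs.1 hσ with h | h
  · obtain ⟨G, hG⟩ := exists_inverseBranch_pos h
    exact hG.mem_derivedSet hσ
  · obtain ⟨G, hG⟩ := exists_inverseBranch_neg (lt_neg_of_lt_neg h)
    exact hG.mem_derivedSet hσ

lemma critical_mem_continuousLocus {v₀ : ℝ} (hv₀ : 0 < v₀) :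
    (qMinus v₀ : ℂ) ∈ continuousLocus (v₀ : ℂ) ∧ (qPlus v₀ : ℂ) ∈ continuousLocus (v₀ : ℂ) := by
  set S := √(1 + v₀) with hS
  have hS2 : S ^ 2 = 1 + v₀ := Real.sq_sqrt (by linarith)
  have hS1 : 1 < S := by rw [hS, Real.lt_sqrt] <;> linarith
  have hSa : 1 < |S| := by rwa [abs_of_pos (by linarith)]
  have h1 := mem_derivedSet_of_one_lt_abs hSa
  have h2 := mem_derivedSet_of_one_lt_abs (σ := -S) (by rwa [abs_neg])
  have hv : S ^ 2 - 1 = v₀ := by linarith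
  have hm : (-S - 1) ^ 2 * (-S + 1) = qMinus v₀ := by
    unfold qMinus; rw [← hS, ← hv]; ring
  have hp : (S - 1) ^ 2 * (S + 1) = qPlus v₀ := by
    unfold qPlus; rw [← hS, ← hv]; ring
  rw [neg_sq, hv, hm] at h2
  rw [hv, hp] at h1
  exact ⟨h2, h1⟩

theorem mainTheorem2 (v₀ : ℝ) (hv₀ : 0 < v₀) :
    qMinus v₀ < qPlus v₀ ∧
    {q : ℝ | (q : ℂ) ∈ continuousLocus (v₀ : ℂ)} = {qMinus v₀, qPlus v₀} ∧
    (∀ q : ℝ, q ≠ qMinus v₀ → q ≠ qPlus v₀ →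
      ∃ U ∈ 𝓝 (q : ℂ), ∀ᶠ m in atTop, ∀ z ∈ U,
        pottsZ (diamondGraph m) z (v₀ : ℂ) = 0 → z = 0) ∧
    (∀ q : ℝ, (q < qMinus v₀ ∨ qPlus v₀ < q) →
      (q : ℂ) ∈ basinLocus ((0 : ℂ) : OnePoint ℂ) (v₀ : ℂ)) ∧
    (∀ q : ℝ, qMinus v₀ < q → q < qPlus v₀ →
      (q : ℂ) ∈ basinLocus OnePoint.infty (v₀ : ℂ)) := by
  refine ⟨qMinus_lt_qPlus hv₀, ?_, fun q h1 h2 => eventuallyZeroFree_of_ne hv₀ h1 h2,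
    fun q hq => mem_basinLocus_zero hv₀ hq, fun q h1 h2 => mem_basinLocus_infty hv₀ h1 h2⟩
  obtain ⟨hm, hp⟩ := critical_mem_continuousLocus hv₀
  ext q
  constructor
  · intro hq
    by_contra hne
    rw [Set.mem_insert_iff, Set.mem_singleton_iff, not_or] at hne
    exact (eventuallyZeroFree_of_ne hv₀ hne.1 hne.2).notMem_derivedSet hq
  · rintro (rfl | rfl)
    · exact hm
    · exact hp
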